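/- Let $K$ be an algebraically closed field of any characteristic, let $n$ be a natural number, and identify $\mathbb G_m^n$ with the group $(K\setminus\{0\})^n$ equipped with the Zariski topology, whose closed sets are the algebraic subsets, i.e. the common zero sets of finitely many Laurent polynomials in $K[X_1^{\pm1},\dots,X_n^{\pm1}]$. Dimension means Krull dimension. A torsion coset is a set $\boldsymbol\zeta G$, where $\boldsymbol\zeta\in\mathbb G_m^n$ has finite order and $G<\mathbb G_m^n$ is an irreducible algebraic subgroup. An algebraic subset $X\subset\mathbb G_m^n$ is called admissible if it is finite or does not contain a torsion coset of dimension $\dim X$. The stabilizer $\mathrm{Stab}(X)$ is the set of $\mathbf g\in\mathbb G_m^n$ with $\mathbf gX\subset X$. For real $T\ge1$ let $X_T$ be the set of points of $X$ that have finite order at most $T$ in the group $\mathbb G_m^n$. Let $X\subset\mathbb G_m^n$ be an irreducible and admissible algebraic subset of dimension $d$, and let $\delta=\dim\mathrm{Stab}(X)$. Then $\delta\le d$, and there is a constant $C$, depending only on $X$ (and on $K$ and $n$), such that for all real $T\ge1$ the set $X_T$ is finite and $$\#X_T\le C\,T^{\,d+1-\frac1{d-\delta+1}}.$$ In particular the exponent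 is strictly smaller than $d+1$. -/

import Mathlib

namespace AlgTorus

/-- The group of `K`-points of the `n`-dimensional algebraic torus, `(K ∖ {0})ⁿ`. -/
abbrev Torus (K : Type*) [Field K] (n : ℕ) : Type _ := Fin n → Kˣ

/-- The ring of Laurent polynomials `K[X₁^{±1}, …, Xₙ^{±1}]`, as the group algebra of `ℤⁿ`. -/
abbrev Laurent (K : Type*) [Field K] (n : ℕ) : Type _ := AddMonoidAlgebra K (Fin n → ℤ)

/-- The monomial character `a ↦ x₁^{a₁} ⋯ xₙ^{aₙ}` of `ℤⁿ` attached to a point `x`. -/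
def monomialAt {K : Type*} [Field K] {n : ℕ} (x : Torus K n) :
    Multiplicative (Fin n → ℤ) →* K where
  toFun a := ((∏ i, x i ^ (a.toAdd i) : Kˣ) : K)
  map_one' := by simp
  map_mul' a b := by
    simp [zpow_add, Finset.prod_mul_distrib]

/-- Evaluation of Laurent polynomials at a point of the torus. -/
noncomputable def evalAt {K : Type*} [Field K] {n : ℕ} (x : Torus K n) : Laurent K n →ₐ[K] K :=
  AddMonoidAlgebra.lift K K (Fin n → ℤ) (monomialAt x)

/-- The common zeros in the torus of a set of Laurent polynomials. -/
def zeroLocus {K : Type*} [Field K] {n : ℕ} (S : Set (Laurent K n)) : Set (Torus K n) :=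
  {x | ∀ P ∈ S, evalAt x P = 0}

/-- Algebraic subsets: common zeros of finitely many Laurent polynomials. -/
def IsAlgebraicSet {K : Type*} [Field K] {n : ℕ} (X : Set (Torus K n)) : Prop :=
  ∃ S : Finset (Laurent K n), X = zeroLocus (S : Set (Laurent K n))

/-- The Zariski topology on the torus: the closed sets are the zero loci of sets of Laurent
polynomials. -/
instance zariskiTopology (K : Type*) [Field K] (n : ℕ) : TopologicalSpace (Torus K n) :=
  TopologicalSpace.ofClosed {X | ∃ S : Set (Laurent K n), X = zeroLocus S}
    ⟨{1}, by ext x; simp [zeroLocus]⟩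
    (by
      intro A hA
      refine ⟨{P | ∃ S : Set (Laurent K n), zeroLocus S ∈ A ∧ P ∈ S}, ?_⟩
      ext x
      simp only [Set.mem_sInter, zeroLocus, Set.mem_ofPred_eq]
      constructor
      · rintro h P ⟨S, hS, hP⟩
        exact h _ hS P hP
      · intro h X hX
        obtain ⟨S, rfl⟩ := hA hX
        exact fun P hP => h P ⟨S, hX, hP⟩)
    (by
      rintro _ ⟨S, rfl⟩ _ ⟨S', rfl⟩
      refine ⟨{R | ∃ P ∈ S, ∃ Q ∈ S', R = P * Q}, ?_⟩
      ext x
      simp only [Set.mem_union, zeroLocus, Set.mem_ofPred_eq]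
      constructor
      · rintro (h | h) _ ⟨P, hP, Q, hQ, rfl⟩
        · rw [map_mul, h P hP, zero_mul]
        · rw [map_mul, h Q hQ, mul_zero]
      · intro h
        by_contra! hc
        obtain ⟨⟨P, hP, hP0⟩, Q, hQ, hQ0⟩ := hc
        have := h (P * Q) ⟨P, hP, Q, hQ, rfl⟩
        rw [map_mul] at this
        exact (mul_ne_zero hP0 hQ0) this)

/-- The dimension of a subset of the torus: the Krull dimension of the subspace, i.e. the supremum
of the lengths of chains of its irreducible closed subsets (`⊥` for the empty set). -/
noncomputable def dim {K : Type*} [Field K] {n : ℕ} (X : Set (Torus K n)) : WithBot ℕ∞ :=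
  topologicalKrullDim X

/-- Linear tori: the irreducible algebraic subgroups. -/
def IsLinearTorus {K : Type*} [Field K] {n : ℕ} (G : Subgroup (Torus K n)) : Prop :=
  IsAlgebraicSet (G : Set (Torus K n)) ∧ IsIrreducible (G : Set (Torus K n))

/-- Torsion cosets `ζG`, with `ζ` a torsion point and `G` a linear torus. -/
def IsTorsionCoset {K : Type*} [Field K] {n : ℕ} (C : Set (Torus K n)) : Prop :=
  ∃ (ζ : Torus K n) (G : Subgroup (Torus K n)),
    IsOfFinOrder ζ ∧ IsLinearTorus G ∧ C = (fun g => ζ * g) '' (G : Set (Torus K n))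

/-- `X` is admissible if it is finite or contains no torsion coset of dimension `dim X`. -/
def IsAdmissible {K : Type*} [Field K] {n : ℕ} (X : Set (Torus K n)) : Prop :=
  X.Finite ∨ ∀ C : Set (Torus K n), IsTorsionCoset C → dim C = dim X → ¬ C ⊆ X

/-- The stabilizer `{g | gX ⊆ X}`. -/
def stab {K : Type*} [Field K] {n : ℕ} (X : Set (Torus K n)) : Set (Torus K n) :=
  {g | ∀ x ∈ X, g * x ∈ X}

/-- The set `X_T` of torsion points of `X` of order at most `T`. -/
def torsionUpTo {K : Type*} [Field K] {n : ℕ} (X : Set (Torus K n)) (T : ℝ) : Set (Torus K n) :=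
  {ζ | ζ ∈ X ∧ IsOfFinOrder ζ ∧ (orderOf ζ : ℝ) ≤ T}

end AlgTorus

/-!
Every torsion point `ζ` of order `N` on a hypersurface `P = 0` in `𝔾ₘᵐ` lies, by Dirichlet's
theorem, on a coset `η · {t ^ a}` of a one-parameter subgroup, where `η` has order `g` and
`‖a‖ g ≪ N ^ (1 - 1 / m)`. Restricted to such a coset, `P` has `O(‖a‖)` zeros unless it vanishes
identically. As `(η, t)` and `(η ω ^ (-a), t ω)` with `ω ^ g = 1` give the same point, each `ζ` is
counted `g` times; summing over the cosets leaves a convergent sum `∑ 1 / g²` and the exponent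
`m - 1 / m`.

If `P` vanishes identically on a coset in some direction through `ζ`, then this direction may be
chosen from a finite set. For each of them the points of this kind form either a proper closed
subset of the hypersurface, where the trivial bound suffices, or the whole of it, in which case the
one-parameter subgroup is divided out: the dimension drops by one, and so does the exponent.

A general variety is mapped to a hypersurface by monomials in a generically finite way, and the
stabilizer is removed beforehand by dividing out its one-parameter subgroups one at a time.
-/

namespace AlgTorus

open Module TopologicalSpace

section Monomials

variable {K : Type*} [Field K] {n k : ℕ}

/-- The value `x^m` at `x` of the character of the torus with exponent vector `m`. -/
def chr (x : Torus K n) (m : Fin n → ℤ) : Kˣ := ∏ i, x i ^ m i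

theorem chr_add (x : Torus K n) (m m' : Fin n → ℤ) : chr x (m + m') = chr x m * chr x m' := by
  simp [chr, zpow_add, Finset.prod_mul_distrib]

@[simp] theorem chr_zero (x : Torus K n) : chr x 0 = 1 := by simp [chr]

theorem chr_mul (x y : Torus K n) (m : Fin n → ℤ) : chr (x * y) m = chr x m * chr y m := by
  simp [chr, mul_zpow, Finset.prod_mul_distrib]

@[simp] theorem chr_one (m : Fin n → ℤ) : chr (1 : Torus K n) m = 1 := by simp [chr]

theorem chr_neg (x : Torus K n) (m : Fin n → ℤ) : chr x (-m) = (chr x m)⁻¹ := by simp [chr]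

theorem chr_sub (x : Torus K n) (m m' : Fin n → ℤ) : chr x (m - m') = chr x m / chr x m' := by
  rw [sub_eq_add_neg, chr_add, chr_neg, div_eq_mul_inv]

theorem chr_smul (x : Torus K n) (c : ℤ) (m : Fin n → ℤ) : chr x (c • m) = chr x m ^ c := by
  simp only [chr, Pi.smul_apply, smul_eq_mul, ← Finset.prod_zpow, mul_comm c, zpow_mul]

theorem chr_sum {ι : Type*} (x : Torus K n) (s : Finset ι) (f : ι → Fin n → ℤ) :
    chr x (∑ i ∈ s, f i) = ∏ i ∈ s, chr x (f i) := by
  induction s using Finset.cons_induction with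
  | empty => simp
  | cons i s hi ih => rw [Finset.sum_cons, Finset.prod_cons, chr_add, ih]

@[simp] theorem chr_single (x : Torus K n) (i : Fin n) (c : ℤ) :
    chr x (Pi.single i c) = x i ^ c := by
  rw [chr, Finset.prod_eq_single i (fun j _ hj => by simp [hj]) (by simp), Pi.single_eq_same]

theorem evalAt_single (x : Torus K n) (m : Fin n → ℤ) (c : K) :
    evalAt x (AddMonoidAlgebra.single m c) = c * (chr x m : K) := by
  simp [evalAt, AddMonoidAlgebra.lift_single, monomialAt, chr]

theorem evalAt_eq_sum (x : Torus K n) (P : Laurent K n) :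
    evalAt x P = ∑ m ∈ P.coeff.support, P.coeff m * (chr x m : K) := by
  simp [evalAt, AddMonoidAlgebra.lift_apply, Finsupp.sum, monomialAt, chr]

theorem exists_eq_evalAt (ψ : Laurent K n →ₐ[K] K) : ∃ x : Torus K n, ψ = evalAt x := by
  let χ : Multiplicative (Fin n → ℤ) →* Kˣ :=
    MonoidHom.toHomUnits ((AddMonoidAlgebra.lift K K (Fin n → ℤ)).symm ψ)
  have hχ (m : Fin n → ℤ) :
      (χ (Multiplicative.ofAdd m) : K) = ψ (AddMonoidAlgebra.single m 1) := rfl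
  refine ⟨fun i => χ (Multiplicative.ofAdd (Pi.single i 1)),
    AddMonoidAlgebra.algHom_ext (fun m => ?_) (by ext)⟩
  rw [evalAt_single, one_mul, ← hχ, Units.val_inj, chr]
  conv_lhs => rw [← Finset.univ_sum_single m, ofAdd_sum, map_prod]
  refine Finset.prod_congr rfl fun i _ => ?_
  rw [← map_zpow, ← ofAdd_zsmul, ← Pi.single_smul, smul_eq_mul, mul_one]

/-- The monomial homomorphism `x ↦ (x^{B₁}, …, x^{Bₖ})` attached to the rows of an integer
matrix. -/
def monomialMap (B : Fin k → Fin n → ℤ) : Torus K n →* Torus K k where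
  toFun x j := chr x (B j)
  map_one' := by ext; simp
  map_mul' x y := by ext; simp [chr_mul]

theorem monomialMap_apply (B : Fin k → Fin n → ℤ) (x : Torus K n) (j : Fin k) :
    monomialMap B x j = chr x (B j) := rfl

theorem monomialMap_single (x : Torus K n) : monomialMap (fun i => Pi.single i 1) x = x := by
  ext i; simp [monomialMap_apply]

theorem chr_monomialMap (B : Fin k → Fin n → ℤ) (x : Torus K n) (m : Fin k → ℤ) :
    chr (monomialMap B x) m = chr x (∑ j, m j • B j) := by
  simp only [chr_sum, chr_smul]
  rfl

/-- The comorphism of `x ↦ g * monomialMap B x`. -/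
noncomputable def pullback (g : Torus K k) (B : Fin k → Fin n → ℤ) :
    Laurent K k →ₐ[K] Laurent K n :=
  AddMonoidAlgebra.lift K (Laurent K n) (Fin k → ℤ)
    { toFun := fun m => AddMonoidAlgebra.single (∑ j, m.toAdd j • B j) (chr g m.toAdd : K)
      map_one' := by simp [AddMonoidAlgebra.one_def]
      map_mul' := fun a b => by
        simp [AddMonoidAlgebra.single_mul_single, chr_add, add_smul, Finset.sum_add_distrib] }

theorem evalAt_pullback (g : Torus K k) (B : Fin k → Fin n → ℤ) (x : Torus K n)
    (P : Laurent K k) : evalAt x (pullback g B P) = evalAt (g * monomialMap B x) P := by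
  have : (evalAt x).comp (pullback g B) = evalAt (g * monomialMap B x) :=
    AddMonoidAlgebra.algHom_ext
      (fun m => by simp [pullback, evalAt_single, chr_mul, chr_monomialMap]) (by ext)
  exact DFunLike.congr_fun this P

end Monomials

section ZariskiTopology

variable {K : Type*} [Field K] {n k : ℕ}

theorem isClosed_iff {X : Set (Torus K n)} :
    IsClosed X ↔ ∃ S : Set (Laurent K n), X = zeroLocus S := by
  rw [← isOpen_compl_iff]
  change Xᶜᶜ ∈ _ ↔ _
  rw [compl_compl]; rfl

theorem isClosed_zeroLocus (S : Set (Laurent K n)) : IsClosed (zeroLocus S) :=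
  isClosed_iff.2 ⟨S, rfl⟩

theorem isClosed_setOf_evalAt_eq_zero (P : Laurent K n) :
    IsClosed {x : Torus K n | evalAt x P = 0} := by
  simpa only [zeroLocus, Set.mem_singleton_iff, forall_eq] using isClosed_zeroLocus {P}

theorem IsAlgebraicSet.isClosed {X : Set (Torus K n)} (h : IsAlgebraicSet X) : IsClosed X := by
  obtain ⟨S, rfl⟩ := h
  exact isClosed_zeroLocus _

theorem continuous_mul_monomialMap (g : Torus K k) (B : Fin k → Fin n → ℤ) :
    Continuous fun x : Torus K n => g * monomialMap B x := by
  refine continuous_iff_isClosed.2 fun C hC => ?_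
  obtain ⟨S, rfl⟩ := isClosed_iff.1 hC
  refine isClosed_iff.2 ⟨pullback g B '' S, ?_⟩
  ext x
  simp [zeroLocus, evalAt_pullback]

theorem continuous_monomialMap (B : Fin k → Fin n → ℤ) :
    Continuous (monomialMap B : Torus K n → Torus K k) := by
  simpa only [one_mul] using continuous_mul_monomialMap (1 : Torus K k) B

theorem continuous_mul_left_torus (g : Torus K n) : Continuous fun x : Torus K n => g * x := by
  simpa only [monomialMap_single] using continuous_mul_monomialMap g (fun i => Pi.single i 1)

/-- Multiplication by `g`, as a homeomorphism of the torus for the Zariski topology. -/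
def translate (g : Torus K n) : Torus K n ≃ₜ Torus K n where
  toEquiv := Equiv.mulLeft g
  continuous_toFun := continuous_mul_left_torus g
  continuous_invFun := continuous_mul_left_torus g⁻¹

/-- The ideal of Laurent polynomials vanishing on `X`. -/
def vanishingIdeal (X : Set (Torus K n)) : Ideal (Laurent K n) where
  carrier := {P | ∀ x ∈ X, evalAt x P = 0}
  zero_mem' := by simp
  add_mem' := fun ha hb x hx => by simp [ha x hx, hb x hx]
  smul_mem' := fun c P hP x hx => by simp [hP x hx]

theorem mem_vanishingIdeal {X : Set (Torus K n)} {P : Laurent K n} :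
    P ∈ vanishingIdeal X ↔ ∀ x ∈ X, evalAt x P = 0 := Iff.rfl

theorem vanishingIdeal_anti {X Y : Set (Torus K n)} (h : X ⊆ Y) :
    vanishingIdeal Y ≤ vanishingIdeal X :=
  fun _ hP x hx => hP x (h hx)

theorem zeroLocus_vanishingIdeal {X : Set (Torus K n)} (hX : IsClosed X) :
    zeroLocus (vanishingIdeal X : Set (Laurent K n)) = X := by
  obtain ⟨S, rfl⟩ := isClosed_iff.1 hX
  exact Set.Subset.antisymm (fun x hx P hP => hx P fun y hy => hy P hP) fun x hx P hP => hP x hx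

theorem eq_of_vanishingIdeal_eq {X Y : Set (Torus K n)} (hX : IsClosed X) (hY : IsClosed Y)
    (h : vanishingIdeal X = vanishingIdeal Y) : X = Y := by
  rw [← zeroLocus_vanishingIdeal hX, ← zeroLocus_vanishingIdeal hY, h]

theorem vanishingIdeal_closure (X : Set (Torus K n)) :
    vanishingIdeal (closure X) = vanishingIdeal X :=
  le_antisymm (vanishingIdeal_anti subset_closure) fun P hP _ hx =>
    closure_minimal hP (isClosed_setOf_evalAt_eq_zero P) hx

theorem exists_evalAt_ne_zero {X : Set (Torus K n)} (hX : IsClosed X) {x : Torus K n}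
    (hx : x ∉ X) : ∃ P ∈ vanishingIdeal X, evalAt x P ≠ 0 := by
  contrapose! hx
  rwa [← zeroLocus_vanishingIdeal hX]

theorem isPrime_vanishingIdeal_iff {X : Set (Torus K n)} :
    (vanishingIdeal X).IsPrime ↔ IsIrreducible X := by
  refine ⟨fun hX => ⟨?_, isPreirreducible_iff_isClosed_union_isClosed.2 fun Z W hZ hW hZW => ?_⟩,
    fun hX => ⟨?_, fun {P Q} hPQ => ?_⟩⟩
  · rw [Set.nonempty_iff_ne_empty]
    rintro rfl
    exact hX.ne_top (by ext; simp [mem_vanishingIdeal])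
  · by_contra! hc
    obtain ⟨⟨z, hz, hzZ⟩, w, hw, hwW⟩ := hc.imp Set.not_subset.1 Set.not_subset.1
    obtain ⟨P, hP, hPz⟩ := exists_evalAt_ne_zero hZ hzZ
    obtain ⟨Q, hQ, hQw⟩ := exists_evalAt_ne_zero hW hwW
    have hPQ : P * Q ∈ vanishingIdeal X := fun x hx => by
      rcases hZW hx with h | h
      · rw [map_mul, hP x h, zero_mul]
      · rw [map_mul, hQ x h, mul_zero]
    exact (hX.mem_or_mem hPQ).elim (fun h => hPz (h z hz)) fun h => hQw (h w hw)
  · obtain ⟨x, hx⟩ := hX.1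
    rw [Ideal.ne_top_iff_one]
    exact fun h => by simpa using h x hx
  · exact isPreirreducible_iff_isClosed_union_isClosed.1 hX.2 _ _
      (isClosed_setOf_evalAt_eq_zero P) (isClosed_setOf_evalAt_eq_zero Q)
      (fun x hx => mul_eq_zero.1 ((map_mul _ _ _).symm.trans (hPQ x hx)))

instance : IsNoetherianRing (Laurent K n) := Algebra.FiniteType.isNoetherianRing K _

instance : NoetherianSpace (Torus K n) := by
  refine ((noetherianSpace_TFAE (Torus K n)).out 0 1 :
    _ ↔ WellFoundedLT (Closeds (Torus K n))).2 ?_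
  have := (inferInstance : WellFoundedGT (Ideal (Laurent K n)))
  refine StrictAnti.wellFoundedLT
    (f := fun X : Closeds (Torus K n) => vanishingIdeal (X : Set (Torus K n))) fun X Y hXY => ?_
  refine lt_of_le_of_ne (vanishingIdeal_anti hXY.le) fun h => hXY.ne ?_
  exact Closeds.ext (eq_of_vanishingIdeal_eq X.isClosed Y.isClosed h.symm)

theorem isAlgebraicSet_of_isClosed {X : Set (Torus K n)} (hX : IsClosed X) :
    IsAlgebraicSet X := by
  obtain ⟨S, hS⟩ := IsNoetherian.noetherian (vanishingIdeal X)
  refine ⟨S, ?_⟩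
  conv_lhs => rw [← zeroLocus_vanishingIdeal hX, ← hS]
  refine Set.Subset.antisymm (fun x hx P hP => hx P (Ideal.subset_span hP)) fun x hx P hP => ?_
  have : Ideal.span (S : Set (Laurent K n)) ≤ RingHom.ker (evalAt x) := Ideal.span_le.2 hx
  exact this hP

theorem vanishingIdeal_zeroLocus [IsAlgClosed K] (P : Ideal (Laurent K n)) [P.IsPrime] :
    vanishingIdeal (zeroLocus (P : Set (Laurent K n))) = P := by
  refine le_antisymm (fun f hf => ?_) fun f hf x hx => hx f hf
  have hJ : IsJacobsonRing (Laurent K n) := isJacobsonRing_of_finiteType (A := K)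
  have hjac : P.jacobson = P := IsJacobsonRing.out inferInstance (Ideal.IsPrime.isRadical ‹_›)
  rw [← hjac, Ideal.jacobson, Ideal.mem_sInf]
  rintro M ⟨hPM, hM⟩
  let _ : Field (Laurent K n ⧸ M) := Ideal.Quotient.field M
  have := finite_of_finite_type_of_isJacobsonRing K (Laurent K n ⧸ M)
  let e : K ≃ₐ[K] (Laurent K n ⧸ M) := AlgEquiv.ofBijective (Algebra.ofId K _)
    (IsAlgClosed.algebraMap_bijective_of_isIntegral)
  obtain ⟨x, hx⟩ := exists_eq_evalAt ((e.symm : _ →ₐ[K] K).comp (Ideal.Quotient.mkₐ K M))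
  have mem_iff (g : Laurent K n) : evalAt x g = 0 ↔ g ∈ M := by
    simp [← hx, Ideal.Quotient.eq_zero_iff_mem]
  exact (mem_iff f).1 (hf x fun g hg => (mem_iff g).2 (hPM hg))

end ZariskiTopology

section Dimension

theorem injective_of_surjective_of_trdeg_le {K A B : Type*} [Field K] [CommRing A] [IsDomain A]
    [CommRing B] [IsDomain B] [Algebra K A] [Algebra K B] [Algebra.FiniteType K A]
    [Algebra.FiniteType K B] (φ : A →ₐ[K] B) (hφ : Function.Surjective φ)
    (h : (Algebra.trdeg K A).toNat ≤ (Algebra.trdeg K B).toNat) : Function.Injective φ := by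
  obtain ⟨t, ht⟩ := exists_isTranscendenceBasis K B
  have hA : Algebra.trdeg K A < Cardinal.aleph0 := trdeg_lt_aleph0_of_finiteType
  have hB : Algebra.trdeg K B < Cardinal.aleph0 := trdeg_lt_aleph0_of_finiteType
  have hcard := ht.cardinalMk_eq_trdeg
  have : Finite t := Cardinal.lt_aleph0_iff_finite.1 (hcard ▸ hB)
  choose x hx using fun y : t => hφ y
  have hφx : ⇑φ ∘ x = (↑) := funext hx
  have hx_indep : AlgebraicIndependent K x := .of_comp φ (hφx ▸ ht.1)
  have hx_basis : IsTranscendenceBasis K x := by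
    refine hx_indep.isTranscendenceBasis_of_lift_trdeg_le_of_finite ?_
    have : Nat.card t = (Algebra.trdeg K B).toNat := by rw [← hcard]; rfl
    rw [← Cardinal.cast_toNat_of_lt_aleph0 hA, ← Nat.cast_card, Cardinal.lift_natCast,
      Cardinal.lift_natCast, this]
    exact_mod_cast h
  have hker : (RingHom.ker φ).comap (algebraMap (Algebra.adjoin K (Set.range x)) A) = ⊥ := by
    refine eq_bot_iff.2 fun ⟨r, hr⟩ hφr => ?_
    rw [Algebra.adjoin_range_eq_range_aeval] at hr
    obtain ⟨p, rfl⟩ := hr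
    have hp : MvPolynomial.aeval ((↑) : t → B) p = 0 := by
      rw [← hφx]
      exact (MvPolynomial.comp_aeval_apply x φ p).symm.trans hφr
    have hp0 : p = 0 := (map_eq_zero_iff _ ht.1).1 hp
    exact Subtype.ext (by simp [hp0])
  have := hx_basis.isAlgebraic
  refine (injective_iff_map_eq_zero φ).2 fun f hf => ?_
  by_contra hf0
  exact Ideal.comap_ne_bot_of_algebraic_mem hf0 hf (Algebra.IsAlgebraic.isAlgebraic f) hker

theorem trdeg_le_ringKrullDim (K A : Type*) [Field K] [CommRing A] [IsDomain A] [Algebra K A]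
    [Algebra.FiniteType K A] :
    ((Algebra.trdeg K A).toNat : WithBot ℕ∞) ≤ ringKrullDim A := by
  obtain ⟨s, g, hg, hint⟩ := exists_integral_inj_algHom_of_fg K A
  algebraize [g.toRingHom]
  have : FaithfulSMul (MvPolynomial (Fin s) K) A := (faithfulSMul_iff_algebraMap_injective _ _).2 hg
  have : Algebra.IsIntegral (MvPolynomial (Fin s) K) A := ⟨hint⟩
  have htrdeg : (Algebra.trdeg K A).toNat = s := by
    have h := lift_trdeg_add_eq K (MvPolynomial (Fin s) K) A
    rw [trdeg_eq_zero (R := MvPolynomial (Fin s) K) (A := A)] at h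
    simpa using (congrArg Cardinal.toNat h).symm
  have hdim : (s : WithBot ℕ∞) ≤ Order.krullDim (PrimeSpectrum (MvPolynomial (Fin s) K)) := by
    rw [← ringKrullDim, MvPolynomial.ringKrullDim_of_isNoetherianRing]
    simp
  obtain ⟨l, hl⟩ := Order.le_krullDim_iff.1 hdim
  obtain ⟨P, hP⟩ := Algebra.IsIntegral.comap_surjective (MvPolynomial (Fin s) K) A l.head
  have : P.asIdeal.LiesOver l.head.asIdeal := ⟨congrArg PrimeSpectrum.asIdeal hP.symm⟩
  obtain ⟨L, hL, -⟩ := Ideal.exists_ltSeries_of_hasGoingUp l P.asIdeal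
  rw [htrdeg, ← hl, ← hL]
  exact Order.LTSeries.length_le_krullDim L

variable {K : Type*} [Field K] {n : ℕ}

/-- The coordinate ring of `X`. -/
abbrev CoordRing (X : Set (Torus K n)) : Type _ := Laurent K n ⧸ vanishingIdeal X

/-- The transcendence degree of the coordinate ring of `X`: an algebraic substitute for the
dimension of an irreducible closed set. -/
noncomputable def tr (X : Set (Torus K n)) : ℕ := (Algebra.trdeg K (CoordRing X)).toNat

theorem tr_closure (X : Set (Torus K n)) : tr (closure X) = tr X := by
  unfold tr CoordRing; rw [vanishingIdeal_closure]

theorem coe_tr (X : Set (Torus K n)) : (tr X : Cardinal) = Algebra.trdeg K (CoordRing X) :=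
  Cardinal.cast_toNat_of_lt_aleph0 trdeg_lt_aleph0_of_finiteType

theorem eq_of_subset_of_tr_le {X Y : Set (Torus K n)} (hX : IsClosed X) (hXi : IsIrreducible X)
    (hY : IsClosed Y) (hYi : IsIrreducible Y) (hYX : Y ⊆ X) (h : tr X ≤ tr Y) : Y = X := by
  have := isPrime_vanishingIdeal_iff.2 hXi
  have := isPrime_vanishingIdeal_iff.2 hYi
  have hle := vanishingIdeal_anti hYX
  have hinj := injective_of_surjective_of_trdeg_le (Ideal.Quotient.factorₐ K hle)
    (Ideal.Quotient.factor_surjective hle) h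
  refine eq_of_vanishingIdeal_eq hY hX (le_antisymm (fun f hf => ?_) hle)
  rw [← Ideal.Quotient.eq_zero_iff_mem] at hf ⊢
  exact (map_eq_zero_iff _ hinj).1 hf

theorem tr_lt_of_ssubset {X Y : Set (Torus K n)} (hX : IsClosed X) (hXi : IsIrreducible X)
    (hY : IsClosed Y) (hYi : IsIrreducible Y) (hYX : Y ⊂ X) : tr Y < tr X :=
  lt_of_not_ge fun h => hYX.ne (eq_of_subset_of_tr_le hX hXi hY hYi hYX.subset h)

theorem isIrreducible_preimage_val {α : Type*} [TopologicalSpace α] {X Z : Set α} (hZX : Z ⊆ X)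
    (hZ : IsIrreducible Z) : IsIrreducible (Subtype.val ⁻¹' Z : Set X) := by
  obtain ⟨z, hz⟩ := hZ.1
  refine ⟨⟨⟨z, hZX hz⟩, hz⟩, ?_⟩
  rintro _ _ ⟨U, hU, rfl⟩ ⟨V, hV, rfl⟩ ⟨x, hxZ, hxU⟩ ⟨y, hyZ, hyV⟩
  obtain ⟨z, hzZ, hz⟩ := hZ.2 U V hU hV ⟨x, hxZ, hxU⟩ ⟨y, hyZ, hyV⟩
  exact ⟨⟨z, hZX hzZ⟩, hzZ, hz⟩

theorem tr_le_dim [IsAlgClosed K] {X : Set (Torus K n)} (hX : IsClosed X)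
    (hirr : IsIrreducible X) : (tr X : WithBot ℕ∞) ≤ dim X := by
  have := isPrime_vanishingIdeal_iff.2 hirr
  refine (trdeg_le_ringKrullDim K (CoordRing X)).trans ?_
  rw [ringKrullDim, ← Order.krullDim_orderDual, dim, topologicalKrullDim]
  let Q (p : PrimeSpectrum (CoordRing X)) : Ideal (Laurent K n) :=
    p.asIdeal.comap (Ideal.Quotient.mk (vanishingIdeal X))
  have hQprime (p) : (Q p).IsPrime := Ideal.comap_isPrime _ _
  have hQ (p) : vanishingIdeal X ≤ Q p := fun f hf => by
    simp [Q, Ideal.Quotient.eq_zero_iff_mem.2 hf]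
  have hsub (p) : zeroLocus (Q p : Set (Laurent K n)) ⊆ X := fun x hx => by
    rw [← zeroLocus_vanishingIdeal hX]
    exact fun f hf => hx f (hQ p hf)
  let F (p : (PrimeSpectrum (CoordRing X))ᵒᵈ) : IrreducibleCloseds X :=
    { carrier := Subtype.val ⁻¹' zeroLocus (Q (OrderDual.ofDual p) : Set (Laurent K n))
      isIrreducible' := isIrreducible_preimage_val (hsub _)
        (isPrime_vanishingIdeal_iff.1 (by rw [vanishingIdeal_zeroLocus]; exact hQprime _))
      isClosed' := (isClosed_zeroLocus _).preimage continuous_subtype_val }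
  have hF : Function.Injective F := fun p q hpq => by
    have h : zeroLocus (Q (OrderDual.ofDual p) : Set (Laurent K n)) =
        zeroLocus (Q (OrderDual.ofDual q) : Set (Laurent K n)) :=
      (Subtype.preimage_val_eq_preimage_val_iff _ _ _).1 (congrArg IrreducibleCloseds.carrier hpq)
        |> fun h => by simpa only [Set.inter_eq_right.2 (hsub _)] using h
    replace h := congrArg vanishingIdeal h
    rw [vanishingIdeal_zeroLocus, vanishingIdeal_zeroLocus] at h
    exact OrderDual.ofDual.injective (PrimeSpectrum.ext
      (Ideal.comap_injective_of_surjective _ Ideal.Quotient.mk_surjective h))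
  refine Order.krullDim_le_of_strictMono F (Monotone.strictMono_of_injective ?_ hF)
  exact fun p q hpq x hx f hf => hx f (Ideal.comap_mono (OrderDual.ofDual_le_ofDual.2 hpq) hf)

end Dimension

section Counting

variable {K : Type*} [Field K] {n k : ℕ}

theorem encard_le_mul_encard_of_fiber {α β : Type*} {A : Set α} {B : Set β} {f : α → β}
    (hf : Set.MapsTo f A B) (hB : B.Finite) {C : ℕ∞}
    (h : ∀ b ∈ B, {a ∈ A | f a = b}.encard ≤ C) : A.encard ≤ B.encard * C := by
  lift B to Finset β using hB
  calc A.encard ≤ (⋃ b ∈ B, {a ∈ A | f a = b}).encard :=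
        Set.encard_le_encard fun a ha => Set.mem_biUnion (hf ha) ⟨ha, rfl⟩
    _ ≤ ∑ b ∈ B, {a ∈ A | f a = b}.encard := B.set_encard_biUnion_le _
    _ ≤ B.card • C := Finset.sum_le_card_nsmul _ _ _ h
    _ = (B : Set β).encard * C := by rw [Set.encard_coe_eq_coe_finsetCard, nsmul_eq_mul]

theorem encard_setOf_forall_isRoot_le {p : Fin n → Polynomial K} (hp : ∀ i, p i ≠ 0) :
    {x : Torus K n | ∀ i, (p i).IsRoot (x i)}.encard ≤ ↑(∏ i, (p i).natDegree) := by
  classical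
  have hmaps : Set.MapsTo (fun (x : Torus K n) i => (x i : K)) {x | ∀ i, (p i).IsRoot (x i)}
      (Set.univ.pi fun i => (p i).roots.toFinset) := fun x hx i _ => by
    simpa [hp i] using hx i
  have hinj : Function.Injective fun (x : Torus K n) i => (x i : K) :=
    fun x y hxy => funext fun i => Units.ext (congrFun hxy i)
  refine (Set.encard_le_encard_of_injOn hmaps hinj.injOn).trans ?_
  rw [Set.encard_pi_eq_prod_encard, Nat.cast_prod]
  refine Finset.prod_le_prod' fun i _ => ?_
  rw [Set.encard_coe_eq_coe_finsetCard]
  exact_mod_cast (Multiset.toFinset_card_le _).trans (Polynomial.card_roots' _)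

theorem encard_setOf_pow_eq_one_le {N : ℕ} (hN : N ≠ 0) :
    {x : Torus K k | x ^ N = 1}.encard ≤ ↑(N ^ k) := by
  have h := encard_setOf_forall_isRoot_le (n := k) fun _ =>
    (Polynomial.monic_X_pow_sub_C (1 : K) hN).ne_zero
  simpa [Polynomial.IsRoot.def, funext_iff, sub_eq_zero, Units.ext_iff,
    Polynomial.natDegree_X_pow_sub_C, -map_one] using h

theorem torsionUpTo_subset_biUnion (X : Set (Torus K n)) (T : ℝ) :
    torsionUpTo X T ⊆ ⋃ N ∈ Finset.Icc 1 ⌊T⌋₊, {x : Torus K n | x ^ N = 1} := fun x hx =>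
  Set.mem_biUnion (Finset.mem_coe.2
    (Finset.mem_Icc.2 ⟨hx.2.1.orderOf_pos, Nat.le_floor hx.2.2⟩)) (pow_orderOf_eq_one x)

theorem finite_torsionUpTo (X : Set (Torus K n)) (T : ℝ) : (torsionUpTo X T).Finite :=
  (Set.Finite.biUnion (Finset.finite_toSet _) fun _ hN => Set.finite_of_encard_le_coe
    (encard_setOf_pow_eq_one_le (Nat.one_le_iff_ne_zero.1 (Finset.mem_Icc.1 hN).1))).subset
    (torsionUpTo_subset_biUnion X T)

theorem torsionUpTo_mono {X Y : Set (Torus K n)} (h : X ⊆ Y) (T : ℝ) :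
    torsionUpTo X T ⊆ torsionUpTo Y T := fun _ hx => ⟨h hx.1, hx.2⟩

/-- The number of torsion points of order at most `T` on `X` is `O(T ^ e)`. -/
def TorsionBound (X : Set (Torus K n)) (e : ℝ) : Prop :=
  ∃ C : ℝ, ∀ T : ℝ, 1 ≤ T → ((torsionUpTo X T).ncard : ℝ) ≤ C * T ^ e

theorem TorsionBound.mono {X Y : Set (Torus K n)} {e e' : ℝ} (h : TorsionBound Y e) (hXY : X ⊆ Y)
    (he : e ≤ e') : TorsionBound X e' := by
  obtain ⟨C, hC⟩ := h
  have hC0 : 0 ≤ C := by simpa using (Nat.cast_nonneg _).trans (hC 1 le_rfl)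
  refine ⟨C, fun T hT => ?_⟩
  calc ((torsionUpTo X T).ncard : ℝ) ≤ (torsionUpTo Y T).ncard := by
        exact_mod_cast Set.ncard_le_ncard (torsionUpTo_mono hXY T) (finite_torsionUpTo Y T)
    _ ≤ C * T ^ e := hC T hT
    _ ≤ C * T ^ e' := by gcongr

theorem TorsionBound.union {X Y : Set (Torus K n)} {e : ℝ} (hX : TorsionBound X e)
    (hY : TorsionBound Y e) : TorsionBound (X ∪ Y) e := by
  obtain ⟨C, hC⟩ := hX
  obtain ⟨D, hD⟩ := hY
  refine ⟨C + D, fun T hT => ?_⟩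
  have hunion : torsionUpTo (X ∪ Y) T = torsionUpTo X T ∪ torsionUpTo Y T := by
    ext x; simp only [torsionUpTo, Set.mem_ofPred_eq, Set.mem_union]; tauto
  calc ((torsionUpTo (X ∪ Y) T).ncard : ℝ)
      ≤ (torsionUpTo X T).ncard + (torsionUpTo Y T).ncard := by
        rw [hunion]; exact_mod_cast Set.ncard_union_le _ _
    _ ≤ C * T ^ e + D * T ^ e := add_le_add (hC T hT) (hD T hT)
    _ = (C + D) * T ^ e := by ring

theorem torsionBound_of_forall_not_isOfFinOrder {X : Set (Torus K n)} (e : ℝ)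
    (h : ∀ x ∈ X, ¬ IsOfFinOrder x) : TorsionBound X e := by
  have hempty (T : ℝ) : torsionUpTo X T = ∅ :=
    Set.eq_empty_of_forall_notMem fun x hx => h x hx.1 hx.2.1
  exact ⟨0, fun T _ => by simp [hempty]⟩

theorem torsionBound_of_finite {X : Set (Torus K n)} (hX : X.Finite) {e : ℝ} (he : 0 ≤ e) :
    TorsionBound X e := by
  refine ⟨X.ncard, fun T hT => ?_⟩
  have h : ((torsionUpTo X T).ncard : ℝ) ≤ X.ncard := by
    exact_mod_cast Set.ncard_le_ncard (s := torsionUpTo X T) (fun x hx => hx.1) hX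
  exact h.trans (le_mul_of_one_le_right (Nat.cast_nonneg _) (Real.one_le_rpow hT he))

theorem TorsionBound.biUnion {ι : Type*} {S : Set ι} (hS : S.Finite) {X : ι → Set (Torus K n)}
    {e : ℝ} (h : ∀ i ∈ S, TorsionBound (X i) e) : TorsionBound (⋃ i ∈ S, X i) e := by
  induction S, hS using Set.Finite.induction_on with
  | empty => exact torsionBound_of_forall_not_isOfFinOrder e (by simp)
  | @insert i S _ _ ih =>
    rw [Set.biUnion_insert]
    exact (h i (Set.mem_insert _ _)).union (ih fun j hj => h j (Set.mem_insert_of_mem _ hj))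

theorem TorsionBound.of_irreducible_subsets {Z : Set (Torus K n)} (hZ : IsClosed Z) {e : ℝ}
    (h : ∀ Y ⊆ Z, IsClosed Y → IsIrreducible Y → TorsionBound Y e) : TorsionBound Z e := by
  obtain ⟨S, hS, hSc, hSi, hZS⟩ := NoetherianSpace.exists_finite_set_isClosed_irreducible hZ
  rw [hZS, Set.sUnion_eq_biUnion]
  exact .biUnion hS fun Y hY =>
    h Y (hZS ▸ Set.subset_sUnion_of_mem hY) (hSc Y hY) (hSi Y hY)

theorem TorsionBound.of_fiber {X : Set (Torus K n)} {Y : Set (Torus K k)} {e : ℝ}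
    (f : Torus K n →* Torus K k) (hf : Set.MapsTo f X Y) {C : ℕ}
    (h : ∀ y, {x ∈ X | f x = y}.encard ≤ C) (hY : TorsionBound Y e) : TorsionBound X e := by
  obtain ⟨D, hD⟩ := hY
  refine ⟨D * C, fun T hT => ?_⟩
  have hmaps : Set.MapsTo f (torsionUpTo X T) (torsionUpTo Y T) := fun x hx =>
    ⟨hf hx.1, f.isOfFinOrder hx.2.1, le_trans
      (mod_cast Nat.le_of_dvd hx.2.1.orderOf_pos (orderOf_map_dvd f x)) hx.2.2⟩
  have hcount := encard_le_mul_encard_of_fiber hmaps (finite_torsionUpTo Y T) (C := C)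
    fun y _ => (Set.encard_le_encard (Set.inter_subset_inter_left _ fun x hx => hx.1)).trans (h y)
  rw [← (finite_torsionUpTo X T).cast_ncard_eq, ← (finite_torsionUpTo Y T).cast_ncard_eq]
    at hcount
  calc ((torsionUpTo X T).ncard : ℝ) ≤ (torsionUpTo Y T).ncard * C := by exact_mod_cast hcount
    _ ≤ D * T ^ e * C := by gcongr; exact hD T hT
    _ = D * C * T ^ e := by ring

theorem torsionBound_univ (k : ℕ) : TorsionBound (Set.univ : Set (Torus K k)) (k + 1) := by
  refine ⟨1, fun T hT => ?_⟩
  have hcount : (torsionUpTo (Set.univ : Set (Torus K k)) T).encard ≤ ↑(⌊T⌋₊ * ⌊T⌋₊ ^ k) :=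
    calc (torsionUpTo (Set.univ : Set (Torus K k)) T).encard
        ≤ ∑ N ∈ Finset.Icc 1 ⌊T⌋₊, {x : Torus K k | x ^ N = 1}.encard :=
          (Set.encard_le_encard (torsionUpTo_subset_biUnion _ T)).trans
            (Finset.set_encard_biUnion_le _ _)
      _ ≤ (Finset.Icc 1 ⌊T⌋₊).card • ↑(⌊T⌋₊ ^ k) := by
          refine Finset.sum_le_card_nsmul _ _ _ fun N hN => ?_
          obtain ⟨hN0, hNT⟩ := Finset.mem_Icc.1 hN
          exact (encard_setOf_pow_eq_one_le (Nat.one_le_iff_ne_zero.1 hN0)).trans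
            (mod_cast Nat.pow_le_pow_left hNT k)
      _ = ↑(⌊T⌋₊ * ⌊T⌋₊ ^ k) := by simp
  rw [← (finite_torsionUpTo _ T).cast_ncard_eq, Nat.cast_le] at hcount
  have hT0 : 0 ≤ T := zero_le_one.trans hT
  calc ((torsionUpTo (Set.univ : Set (Torus K k)) T).ncard : ℝ) ≤ ⌊T⌋₊ * (⌊T⌋₊ : ℝ) ^ k := by
        exact_mod_cast hcount
    _ ≤ T * T ^ k := by have := Nat.floor_le hT0; gcongr
    _ = 1 * T ^ ((k : ℝ) + 1) := by
        rw [one_mul, ← pow_succ', ← Real.rpow_natCast]; push_cast; rfl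

end Counting

section Coordinates

variable {K : Type*} [Field K] {n : ℕ} {ι : Type*}

/-- The class of the monomial `x^m` in the coordinate ring. -/
noncomputable def mon (X : Set (Torus K n)) (m : Fin n → ℤ) : CoordRing X :=
  Ideal.Quotient.mk (vanishingIdeal X) (AddMonoidAlgebra.single m 1)

/-- The substitution of the monomials `x^{f j}` for the variables of a polynomial. -/
noncomputable def substMon (f : ι → Fin n → ℤ) : MvPolynomial ι K →ₐ[K] Laurent K n :=
  MvPolynomial.aeval fun j => AddMonoidAlgebra.single (f j) 1

theorem evalAt_substMon (f : ι → Fin n → ℤ) (x : Torus K n) (p : MvPolynomial ι K) :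
    evalAt x (substMon f p) = MvPolynomial.eval (fun j => (chr x (f j) : K)) p := by
  rw [substMon, MvPolynomial.comp_aeval_apply]
  simp only [evalAt_single, one_mul, MvPolynomial.aeval_eq_eval]

theorem aeval_mon_eq_zero_iff (X : Set (Torus K n)) (f : ι → Fin n → ℤ) (p : MvPolynomial ι K) :
    MvPolynomial.aeval (fun j => mon X (f j)) p = 0 ↔
      ∀ x ∈ X, MvPolynomial.eval (fun j => (chr x (f j) : K)) p = 0 := by
  have hmk : MvPolynomial.aeval (fun j => mon X (f j)) p =
      Ideal.Quotient.mkₐ K (vanishingIdeal X) (substMon f p) := by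
    rw [substMon, MvPolynomial.comp_aeval_apply]; rfl
  rw [hmk, Ideal.Quotient.mkₐ_eq_mk, Ideal.Quotient.eq_zero_iff_mem, mem_vanishingIdeal]
  simp only [evalAt_substMon]

theorem adjoin_range_mon (X : Set (Torus K n)) : Algebra.adjoin K (Set.range (mon X)) = ⊤ := by
  refine eq_top_iff.2 fun u _ => ?_
  obtain ⟨P, rfl⟩ := Ideal.Quotient.mk_surjective u
  induction P using AddMonoidAlgebra.induction_linear with
  | zero => simp
  | add P Q hP hQ => rw [map_add]; exact add_mem (hP trivial) (hQ trivial)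
  | single m c =>
    have hsmul : Ideal.Quotient.mk (vanishingIdeal X) (AddMonoidAlgebra.single m c) =
        c • mon X m := by
      rw [mon, ← Ideal.Quotient.mkₐ_eq_mk K, ← map_smul]; simp
    rw [hsmul]
    exact Subalgebra.smul_mem _ (Algebra.subset_adjoin (Set.mem_range_self m)) c

theorem exists_isTranscendenceBasis_mon {X : Set (Torus K n)} (hX : IsIrreducible X) :
    ∃ f : Fin (tr X) → Fin n → ℤ, IsTranscendenceBasis K fun j => mon X (f j) := by
  have := isPrime_vanishingIdeal_iff.2 hX
  have : Algebra.IsAlgebraic (Algebra.adjoin K (Set.range (mon X))) (CoordRing X) := by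
    rw [adjoin_range_mon]
    exact ⟨fun u => isAlgebraic_algebraMap (⟨u, trivial⟩ : (⊤ : Subalgebra K (CoordRing X)))⟩
  obtain ⟨t, ht, hbasis⟩ := exists_isTranscendenceBasis_subset (R := K) (Set.range (mon X))
  have hcard : Cardinal.mk t = tr X := by rw [hbasis.cardinalMk_eq_trdeg, coe_tr]
  have : Finite t := Cardinal.lt_aleph0_iff_finite.1 (hcard ▸ Cardinal.natCast_lt_aleph0)
  have e : Fin (tr X) ≃ t := (Finite.equivFinOfCardEq (by simp [Nat.card, hcard])).symm
  choose f hf using fun u : t => ht u.2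
  have hfe : (fun j => mon X ((f ∘ e) j)) = Subtype.val ∘ e := funext fun j => hf (e j)
  exact ⟨f ∘ e, hfe ▸ (isTranscendenceBasis_equiv e).2 hbasis⟩

theorem exists_evalAt_substMon_ne_zero {X : Set (Torus K n)} {f : ι → Fin n → ℤ}
    (hf : AlgebraicIndependent K fun j => mon X (f j)) {p : MvPolynomial ι K} (hp : p ≠ 0) :
    ∃ x ∈ X, evalAt x (substMon f p) ≠ 0 := by
  simp only [evalAt_substMon]
  contrapose! hp
  exact (map_eq_zero_iff _ hf).1 ((aeval_mon_eq_zero_iff X f p).2 hp)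

theorem exists_polynomial_forall_isRoot {X : Set (Torus K n)} {f : ι → Fin n → ℤ}
    (hf : IsTranscendenceBasis K fun j => mon X (f j)) (m : Fin n → ℤ) :
    ∃ q : Polynomial (MvPolynomial ι K), q ≠ 0 ∧ ∀ x ∈ X,
      (q.map (MvPolynomial.eval fun j => (chr x (f j) : K))).IsRoot (chr x m : K) := by
  have hdep : ¬ AlgebraicIndependent K fun o : Option ι => mon X (o.elim m f) := by
    have h := (hf.1.option_iff_transcendental (mon X m)).not.2
      (not_not.2 (hf.isAlgebraic.isAlgebraic _))
    convert h using 3 with o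
    cases o <;> rfl
  rw [algebraicIndependent_iff] at hdep
  push Not at hdep
  obtain ⟨p, hp, hp0⟩ := hdep
  refine ⟨MvPolynomial.optionEquivLeft K ι p, by simpa using hp0, fun x hx => ?_⟩
  rw [Polynomial.IsRoot.def, ← MvPolynomial.optionEquivLeft_elim_eval]
  rw [aeval_mon_eq_zero_iff] at hp
  convert hp x hx using 3
  ext o
  cases o <;> rfl

theorem exists_ssubset_forall_encard_fiber_le {X : Set (Torus K n)} (hX : IsClosed X)
    (hirr : IsIrreducible X) {s : ℕ} {f : Fin s → Fin n → ℤ}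
    (hf : IsTranscendenceBasis K fun j => mon X (f j)) :
    ∃ Z ⊂ X, IsClosed Z ∧ ∃ C : ℕ, ∀ c, {x ∈ X \ Z | monomialMap f x = c}.encard ≤ C := by
  have := isPrime_vanishingIdeal_iff.2 hirr
  choose q hq0 hq using fun i : Fin n => exists_polynomial_forall_isRoot hf (Pi.single i 1)
  set h : MvPolynomial (Fin s) K := ∏ i, (q i).leadingCoeff
  have hh : h ≠ 0 := Finset.prod_ne_zero_iff.2 fun i _ => Polynomial.leadingCoeff_ne_zero.2 (hq0 i)
  obtain ⟨x₀, hx₀, hx₀h⟩ := exists_evalAt_substMon_ne_zero hf.1 hh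
  refine ⟨X ∩ {x | evalAt x (substMon f h) = 0}, ⟨Set.inter_subset_left, fun hX => hx₀h (hX hx₀).2⟩,
    hX.inter (isClosed_setOf_evalAt_eq_zero _), ∏ i, (q i).natDegree, fun c => ?_⟩
  set qc : Fin n → Polynomial K := fun i => (q i).map (MvPolynomial.eval fun j => (c j : K))
  by_cases hc : MvPolynomial.eval (fun j => (c j : K)) h = 0
  · refine (Set.encard_eq_zero.2 (Set.eq_empty_of_forall_notMem ?_)).trans_le zero_le
    rintro x ⟨⟨hx, hxZ⟩, rfl⟩
    exact hxZ ⟨hx, (evalAt_substMon f x h).trans hc⟩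
  · have hqc (i) : qc i ≠ 0 := fun h0 => by
      refine hc ((map_prod _ _ _).trans (Finset.prod_eq_zero (Finset.mem_univ i) ?_))
      simpa [qc] using congrArg (fun p => p.coeff (q i).natDegree) h0
    refine (Set.encard_le_encard ?_).trans ((encard_setOf_forall_isRoot_le hqc).trans
      (mod_cast Finset.prod_le_prod' fun i _ => Polynomial.natDegree_map_le))
    rintro x ⟨⟨hx, -⟩, rfl⟩ i
    have hroot := hq i x hx
    rwa [chr_single, zpow_one] at hroot

theorem torsionBound_of_tr {X : Set (Torus K n)} (hX : IsClosed X) (hirr : IsIrreducible X) :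
    TorsionBound X (tr X + 1) := by
  induction hs : tr X using Nat.strong_induction_on generalizing X with
  | _ s ih =>
  subst hs
  obtain ⟨f, hf⟩ := exists_isTranscendenceBasis_mon hirr
  obtain ⟨Z, hZX, hZ, C, hC⟩ := exists_ssubset_forall_encard_fiber_le hX hirr hf
  have hZ_bound : TorsionBound Z (tr X + 1) := by
    refine .of_irreducible_subsets hZ fun Y hYZ hY hYi => ?_
    have hlt := tr_lt_of_ssubset hX hirr hY hYi (hYZ.trans_ssubset hZX)
    exact (ih _ hlt hY hYi rfl).mono subset_rfl (by gcongr)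
  have hcompl_bound : TorsionBound (X \ Z) (tr X + 1) :=
    .of_fiber (monomialMap f) (Set.mapsTo_univ _ _) hC (torsionBound_univ _)
  exact (hcompl_bound.union hZ_bound).mono (by simp) le_rfl

theorem torsionBound_of_ssubset {X Z : Set (Torus K n)} (hX : IsClosed X) (hirr : IsIrreducible X)
    (hZ : IsClosed Z) (hZX : Z ⊂ X) : TorsionBound Z (tr X) :=
  .of_irreducible_subsets hZ fun _ hYZ hY hYi => (torsionBound_of_tr hY hYi).mono subset_rfl
    (mod_cast tr_lt_of_ssubset hX hirr hY hYi (hYZ.trans_ssubset hZX))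

end Coordinates

section CharacterSums

variable {K : Type*} [Field K]

/-- By the linear independence of characters, only the sums of the coefficients of equal characters
matter. -/
theorem sum_mul_eq_zero_of_sum_mul_character_eq_zero {G ι : Type*} [Monoid G] {s : Finset ι}
    {c : ι → K} {χ : ι → G →* Kˣ} (h : ∀ g, ∑ i ∈ s, c i * (χ i g : K) = 0) {v : ι → K}
    (hv : ∀ i ∈ s, ∀ j ∈ s, χ i = χ j → v i = v j) : ∑ i ∈ s, c i * v i = 0 := by
  classical
  let ψ (i : ι) : G →* K := (Units.coeHom K).comp (χ i)
  have hψ {i j : ι} (hij : ψ i = ψ j) : χ i = χ j :=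
    MonoidHom.ext fun g => Units.ext (DFunLike.congr_fun hij g)
  have hfiber (i : ι) (hi : i ∈ s) : ∑ j ∈ s with ψ j = ψ i, c j = 0 := by
    refine linearIndependent_iff'.1 (linearIndependent_monoidHom G K) (s.image ψ)
      (fun φ => ∑ j ∈ s with ψ j = φ, c j) (funext fun g => ?_) (ψ i) (Finset.mem_image_of_mem ψ hi)
    rw [Pi.zero_apply, ← h g, Finset.sum_apply,
      ← Finset.sum_fiberwise_of_maps_to fun i => Finset.mem_image_of_mem ψ]
    refine Finset.sum_congr rfl fun φ _ => ?_
    simp only [Pi.smul_apply, smul_eq_mul, Finset.sum_mul]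
    exact Finset.sum_congr rfl fun j hj => by rw [← (Finset.mem_filter.1 hj).2]; rfl
  rw [← Finset.sum_fiberwise_of_maps_to (fun i => Finset.mem_image_of_mem ψ)]
  refine Finset.sum_eq_zero fun φ hφ => ?_
  obtain ⟨i, hi, rfl⟩ := Finset.mem_image.1 hφ
  have hvi (j) (hj : j ∈ s.filter fun j => ψ j = ψ i) : c j * v j = c j * v i := by
    rw [hv j (Finset.mem_filter.1 hj).1 i hi (hψ (Finset.mem_filter.1 hj).2)]
  rw [Finset.sum_congr rfl hvi, ← Finset.sum_mul, hfiber i hi, zero_mul]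

theorem zpowGroupHom_injective [Infinite K] :
    Function.Injective (zpowGroupHom : ℤ → Kˣ →* Kˣ) := by
  have hnat (k : ℕ) (hk : ∀ t : Kˣ, t ^ k = 1) : k = 0 := by
    by_contra hk0
    have hp : (Polynomial.X ^ k - Polynomial.C 1) * Polynomial.X = (0 : Polynomial K) := by
      refine Polynomial.funext fun t => ?_
      by_cases ht : t = 0
      · simp [ht]
      · have ht1 : t ^ k = 1 := congrArg Units.val (hk (Units.mk0 t ht))
        simp [ht1]
    exact (mul_ne_zero (Polynomial.X_pow_sub_C_ne_zero (Nat.pos_of_ne_zero hk0) 1)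
      Polynomial.X_ne_zero) hp
  intro e e' h
  rw [← sub_eq_zero, ← Int.natAbs_eq_zero]
  refine hnat _ fun t => ?_
  rw [pow_natAbs_eq_one, zpow_sub, mul_inv_eq_one]
  exact DFunLike.congr_fun h t

end CharacterSums

section OneParameter

variable {K : Type*} [Field K] {n : ℕ}

/-- The one-parameter subgroup `t ↦ t^a`. -/
def cochar (a : Fin n → ℤ) : Kˣ →* Torus K n := MonoidHom.pi fun i => zpowGroupHom (a i)

theorem cochar_apply (a : Fin n → ℤ) (t : Kˣ) (i : Fin n) : cochar a t i = t ^ a i := rfl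

theorem cochar_zero (t : Kˣ) : cochar (0 : Fin n → ℤ) t = 1 := by ext i; simp [cochar_apply]

theorem cochar_add (a b : Fin n → ℤ) (t : Kˣ) : cochar (a + b) t = cochar a t * cochar b t := by
  ext i; simp [cochar_apply, zpow_add]

theorem cochar_smul (c : ℤ) (a : Fin n → ℤ) (t : Kˣ) : cochar (c • a) t = cochar a (t ^ c) := by
  ext i; simp [cochar_apply, zpow_mul]

theorem chr_cochar (a : Fin n → ℤ) (t : Kˣ) (m : Fin n → ℤ) :
    chr (cochar a t) m = t ^ (a ⬝ᵥ m) := by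
  simp only [chr, cochar_apply, dotProduct, ← zpow_mul]
  induction (Finset.univ : Finset (Fin n)) using Finset.cons_induction with
  | empty => simp
  | cons i s hi ih => rw [Finset.prod_cons, Finset.sum_cons, zpow_add, ih]

theorem evalAt_mul_cochar (x : Torus K n) (a : Fin n → ℤ) (t : Kˣ) (P : Laurent K n) :
    evalAt (x * cochar a t) P =
      ∑ m ∈ P.coeff.support, P.coeff m * (chr x m : K) * ((t ^ (a ⬝ᵥ m) : Kˣ) : K) := by
  simp only [evalAt_eq_sum, chr_mul, chr_cochar, Units.val_mul, mul_assoc]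

theorem exists_polynomial_eval_eq (x : Torus K n) (a : Fin n → ℤ) (P : Laurent K n) {D : ℕ}
    (hD : ∀ m ∈ P.coeff.support, |a ⬝ᵥ m| ≤ D) :
    ∃ p : Polynomial K, p.natDegree ≤ 2 * D ∧
      ∀ t : Kˣ, p.eval (t : K) = t ^ D * evalAt (x * cochar a t) P := by
  refine ⟨∑ m ∈ P.coeff.support,
    Polynomial.monomial (a ⬝ᵥ m + D).toNat (P.coeff m * (chr x m : K)),
    Polynomial.natDegree_sum_le_of_forall_le _ _ fun m hm =>
      (Polynomial.natDegree_monomial_le _).trans ?_, fun t => ?_⟩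
  · have := abs_le.1 (hD m hm)
    omega
  · rw [Polynomial.eval_finsetSum, evalAt_mul_cochar, Finset.mul_sum]
    refine Finset.sum_congr rfl fun m hm => ?_
    have hexp : ((a ⬝ᵥ m + D).toNat : ℤ) = D + a ⬝ᵥ m := by
      have := abs_le.1 (hD m hm)
      omega
    have hpow : (t : K) ^ (a ⬝ᵥ m + D).toNat = t ^ D * ((t ^ (a ⬝ᵥ m) : Kˣ) : K) := by
      rw [← Units.val_pow_eq_pow_val, ← Units.val_pow_eq_pow_val, ← Units.val_mul, ← zpow_natCast,
        hexp, zpow_add, zpow_natCast]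
    rw [Polynomial.eval_monomial, hpow]
    ring

theorem encard_setOf_evalAt_mul_cochar_eq_zero_le {x : Torus K n} {a : Fin n → ℤ} {P : Laurent K n}
    {D : ℕ} (hD : ∀ m ∈ P.coeff.support, |a ⬝ᵥ m| ≤ D)
    (hne : ∃ t, evalAt (x * cochar a t) P ≠ 0) :
    {t | evalAt (x * cochar a t) P = 0}.encard ≤ ↑(2 * D) := by
  classical
  obtain ⟨p, hdeg, hp⟩ := exists_polynomial_eval_eq x a P hD
  obtain ⟨t₀, ht₀⟩ := hne
  have hp0 : p ≠ 0 := by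
    rintro rfl
    simpa [ht₀] using hp t₀
  have hmaps : Set.MapsTo Units.val {t | evalAt (x * cochar a t) P = 0} p.roots.toFinset :=
    fun t ht => by
      rw [Set.mem_ofPred_eq] at ht
      simp [hp0, hp, ht]
  refine (Set.encard_le_encard_of_injOn hmaps Units.val_injective.injOn).trans ?_
  rw [Set.encard_coe_eq_coe_finsetCard]
  exact_mod_cast (Multiset.toFinset_card_le _).trans ((Polynomial.card_roots' _).trans hdeg)

/-- Whether `P` vanishes on a coset of `t ↦ t^a` only depends on which exponents of `P` have the
same inner product with `a`. -/
theorem exists_finite_directions [Infinite K] (P : Laurent K n) :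
    ∃ 𝒜 : Set (Fin n → ℤ), 𝒜.Finite ∧ (∀ a ∈ 𝒜, a ≠ 0) ∧
      ∀ (x : Torus K n) (a : Fin n → ℤ), a ≠ 0 → (∀ t, evalAt (x * cochar a t) P = 0) →
        ∃ b ∈ 𝒜, ∀ t, evalAt (x * cochar b t) P = 0 := by
  let R (a : Fin n → ℤ) (m m' : P.coeff.support) : Prop := a ⬝ᵥ m.1 = a ⬝ᵥ m'.1
  obtain ⟨𝒜, h𝒜, hbij⟩ := Set.exists_subset_bijOn {a | a ≠ 0} R
  refine ⟨𝒜, hbij.finite_iff_finite.2 (Set.toFinite _), h𝒜, fun x a ha hP => ?_⟩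
  obtain ⟨b, hb, hR⟩ := hbij.surjOn (Set.mem_image_of_mem R ha)
  refine ⟨b, hb, fun t => ?_⟩
  rw [evalAt_mul_cochar]
  simp only [evalAt_mul_cochar] at hP
  refine sum_mul_eq_zero_of_sum_mul_character_eq_zero (χ := fun m => zpowGroupHom (a ⬝ᵥ m)) hP
    fun m hm m' hm' hχ => ?_
  have hb : R b ⟨m, hm⟩ ⟨m', hm'⟩ := hR ▸ zpowGroupHom_injective hχ
  exact congrArg (fun e : ℤ => ((t ^ e : Kˣ) : K)) hb

end OneParameter

section Approximation

variable {K : Type*} [Field K] {m : ℕ}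

theorem exists_eq_cochar {ζ : Torus K m} (hζ : IsOfFinOrder ζ) :
    ∃ (ξ : Kˣ) (b : Fin m → ℤ), orderOf ξ = orderOf ζ ∧ ζ = cochar b ξ := by
  have : NeZero (orderOf ζ) := ⟨hζ.orderOf_pos.ne'⟩
  obtain ⟨ξ, hξ⟩ := IsCyclic.exists_generator (α := rootsOfUnity (orderOf ζ) K)
  have hmem (i : Fin m) : ζ i ∈ rootsOfUnity (orderOf ζ) K :=
    (mem_rootsOfUnity _ _).2 (congrFun (pow_orderOf_eq_one ζ) i)
  choose b hb using fun i => Subgroup.mem_zpowers_iff.1 (hξ ⟨ζ i, hmem i⟩)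
  have hζb : ζ = cochar b ξ.1 := funext fun i => (congrArg Subtype.val (hb i)).symm
  refine ⟨ξ, b, Nat.dvd_antisymm ?_ ?_, hζb⟩
  · exact orderOf_dvd_of_pow_eq_one ((mem_rootsOfUnity _ _).1 ξ.2)
  · conv_lhs => rw [hζb]
    exact orderOf_map_dvd _ _

/-- Dirichlet's simultaneous approximation theorem, by the pigeonhole principle. -/
theorem exists_abs_mul_sub_mul_le {ι : Type*} [Fintype ι] (b : ι → ℤ) {N Q : ℕ} (hQ : 0 < Q)
    (hQN : Q ^ Fintype.card ι < N) :
    ∃ k : ℕ, 0 < k ∧ k < N ∧ ∃ l : ι → ℤ, ∀ i, |k * b i - N * l i| * Q ≤ N := by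
  classical
  have hN : (0 : ℤ) < N := by omega
  let box (k : ℕ) (i : ι) : ℤ := Q * (k * b i % N) / N
  have hmaps : ∀ k ∈ Finset.range N,
      box k ∈ Fintype.piFinset fun _ : ι => Finset.Ico (0 : ℤ) Q := by
    refine fun k _ => Fintype.mem_piFinset.2 fun i => Finset.mem_Ico.2 ⟨?_, ?_⟩
    · have := Int.emod_nonneg (k * b i) hN.ne'
      positivity
    · refine Int.ediv_lt_of_lt_mul hN (Int.mul_lt_mul_of_pos_left (Int.emod_lt_of_pos _ hN) ?_)
      exact_mod_cast hQ
  obtain ⟨x, hx, y, hy, hxy, hbox⟩ := Finset.exists_ne_map_eq_of_card_lt_of_maps_to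
    (by simpa using hQN) hmaps
  wlog hlt : x < y generalizing x y
  · exact this y hy x hx hxy.symm hbox.symm (lt_of_le_of_ne (not_lt.1 hlt) hxy.symm)
  rw [Finset.mem_range] at hx hy
  refine ⟨y - x, by omega, by omega, fun i => y * b i / N - x * b i / N, fun i => ?_⟩
  have hdiff : ((y - x : ℕ) : ℤ) * b i - N * (y * b i / N - x * b i / N) =
      y * b i % N - x * b i % N := by
    rw [Nat.cast_sub hlt.le, Int.emod_def, Int.emod_def]
    ring
  have hboxi : Q * (x * b i % N) / N = Q * (y * b i % N) / (N : ℤ) := congrFun hbox i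
  have hx_div := Int.mul_ediv_add_emod (Q * (x * b i % N)) N
  have hy_div := Int.mul_ediv_add_emod (Q * (y * b i % N)) N
  have hx_rem := Int.emod_nonneg (Q * (x * b i % N)) hN.ne'
  have hy_rem := Int.emod_nonneg (Q * (y * b i % N)) hN.ne'
  have hx_lt := Int.emod_lt_of_pos (Q * (x * b i % N)) hN
  have hy_lt := Int.emod_lt_of_pos (Q * (y * b i % N)) hN
  rw [hboxi] at hx_div
  rw [hdiff, ← abs_of_nonneg (Int.natCast_nonneg Q), ← abs_mul, sub_mul, abs_le]
  constructor <;> linarith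

/-- If `k b = g a + N l` with `g = gcd(k, N) = u k + v N`, then `b = u a + (N / g) (u l + v b)`. -/
theorem exists_eq_smul_add_smul {ι : Type*} [Fintype ι] {b : ι → ℤ} {N Q : ℕ}
    (hb : ∀ k : ℕ, (∀ i, (N : ℤ) ∣ k * b i) → N ∣ k) (hQ : 0 < Q)
    (hQN : Q ^ Fintype.card ι < N) :
    ∃ (g N' : ℕ) (u : ℤ) (a c : ι → ℤ), N = g * N' ∧ a ≠ 0 ∧ (∀ i, |a i| * g * Q ≤ N) ∧
      b = u • a + (N' : ℤ) • c := by
  obtain ⟨k, hk, hkN, l, hl⟩ := exists_abs_mul_sub_mul_le b hQ hQN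
  obtain ⟨N', hN'⟩ : k.gcd N ∣ N := Nat.gcd_dvd_right k N
  have hbez := Nat.gcd_eq_gcd_ab k N
  have hgk : (k.gcd N : ℤ) ∣ k := mod_cast Nat.gcd_dvd_left k N
  have hgN : (k.gcd N : ℤ) ∣ N := mod_cast Nat.gcd_dvd_right k N
  have hg : (k.gcd N : ℤ) ≠ 0 := mod_cast (Nat.gcd_pos_of_pos_left N hk).ne'
  have hNZ : (N : ℤ) = k.gcd N * N' := mod_cast hN'
  choose a ha using fun i => dvd_sub (hgk.mul_right (b i)) (hgN.mul_right (l i))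
  refine ⟨k.gcd N, N', k.gcdA N, a, k.gcdA N • l + k.gcdB N • b, hN', ?_, fun i => ?_, ?_⟩
  · rintro rfl
    have hdvd : N ∣ k := hb k fun i => ⟨l i, by simpa [sub_eq_zero] using ha i⟩
    exact hkN.not_ge (Nat.le_of_dvd hk hdvd)
  · rw [mul_comm |a i|, ← Int.natCast_natAbs (a i), ← abs_of_nonneg (Int.natCast_nonneg (k.gcd N)),
      Int.natCast_natAbs, ← abs_mul, ← ha i]
    exact hl i
  · ext i
    simp only [Pi.add_apply, Pi.smul_apply, smul_eq_mul]
    apply mul_left_cancel₀ hg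
    linear_combination (b i) * hbez + k.gcdA N * ha i + (k.gcdA N * l i + k.gcdB N * b i) * hNZ

theorem exists_eq_mul_cochar {ζ : Torus K m} (hζ : IsOfFinOrder ζ) {Q : ℕ} (hQ : 0 < Q)
    (hQN : Q ^ m < orderOf ζ) :
    ∃ (g : ℕ) (a : Fin m → ℤ) (η : Torus K m) (τ ω : Kˣ), 0 < g ∧ a ≠ 0 ∧
      (∀ i, |a i| * g * Q ≤ orderOf ζ) ∧ η ^ g = 1 ∧ ζ = η * cochar a τ ∧ orderOf ω = g := by
  obtain ⟨ξ, b, hξ, hb⟩ := exists_eq_cochar hζ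
  have hb_order (k : ℕ) (hk : ∀ i, (orderOf ζ : ℤ) ∣ k * b i) : orderOf ζ ∣ k := by
    refine orderOf_dvd_of_pow_eq_one (funext fun i => ?_)
    rw [hb, ← map_pow, cochar_apply, ← zpow_natCast, ← zpow_mul, Pi.one_apply,
      ← orderOf_dvd_iff_zpow_eq_one, hξ]
    exact hk i
  obtain ⟨g, N', u, a, c, hN, ha, ha_le, hbac⟩ :=
    exists_eq_smul_add_smul hb_order hQ (by simpa using hQN)
  have hN0 : g * N' ≠ 0 := hN ▸ hζ.orderOf_pos.ne'
  have hω : orderOf (ξ ^ N') = g := by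
    rw [orderOf_pow_of_dvd (right_ne_zero_of_mul hN0) (hξ ▸ hN ▸ dvd_mul_left N' g), hξ, hN,
      Nat.mul_div_cancel _ (Nat.pos_of_ne_zero (right_ne_zero_of_mul hN0))]
  refine ⟨g, a, cochar c (ξ ^ N'), ξ ^ u, ξ ^ N', Nat.pos_of_ne_zero (left_ne_zero_of_mul hN0), ha,
    ha_le, ?_, ?_, hω⟩
  · rw [← map_pow, ← hω, pow_orderOf_eq_one, map_one]
  · rw [hb, hbac, cochar_add, cochar_smul, cochar_smul, zpow_natCast, mul_comm]

end Approximation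

section IsolatedPoints

theorem ncard_biUnion_Icc_le {α : Type*} {A : ℕ → Set α} {c e : ℝ} (hc : 0 ≤ c) (he : 1 < e)
    {N : ℕ} (h : ∀ g ∈ Finset.Icc 1 N, ((A g).ncard : ℝ) ≤ c * (1 / (g : ℝ) ^ e)) :
    ((⋃ g ∈ Finset.Icc 1 N, A g).ncard : ℝ) ≤ c * ∑' g : ℕ, 1 / (g : ℝ) ^ e :=
  calc ((⋃ g ∈ Finset.Icc 1 N, A g).ncard : ℝ) ≤ ∑ g ∈ Finset.Icc 1 N, ((A g).ncard : ℝ) := by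
        exact_mod_cast Finset.set_ncard_biUnion_le _ _
    _ ≤ ∑ g ∈ Finset.Icc 1 N, c * (1 / (g : ℝ) ^ e) := Finset.sum_le_sum h
    _ ≤ c * ∑' g : ℕ, 1 / (g : ℝ) ^ e := by
        rw [← Finset.mul_sum]
        gcongr
        exact (Real.summable_one_div_nat_rpow.2 he).sum_le_tsum _ fun _ _ => by positivity

variable {K : Type*} [Field K] {m : ℕ}

theorem exists_abs_dotProduct_le (P : Laurent K m) :
    ∃ D : ℕ, ∀ (a : Fin m → ℤ) (A : ℕ), (∀ i, |a i| ≤ A) →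
      ∀ μ ∈ P.coeff.support, |a ⬝ᵥ μ| ≤ (D * A : ℕ) := by
  refine ⟨P.coeff.support.sup fun μ => ∑ i, (μ i).natAbs, fun a A hA μ hμ => ?_⟩
  calc |a ⬝ᵥ μ| ≤ ∑ i, |a i * μ i| := Finset.abs_sum_le_sum_abs _ _
    _ ≤ ∑ i, (A : ℤ) * (μ i).natAbs := by
        refine Finset.sum_le_sum fun i _ => ?_
        rw [abs_mul, Int.natCast_natAbs]
        exact mul_le_mul_of_nonneg_right (hA i) (abs_nonneg _)
    _ = (((∑ i, (μ i).natAbs) * A : ℕ) : ℤ) := by push_cast; rw [← Finset.mul_sum, mul_comm]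
    _ ≤ _ := mod_cast Nat.mul_le_mul_right A
        (Finset.le_sup (f := fun μ : Fin m → ℤ => ∑ i, (μ i).natAbs) hμ)

/-- The zeros of `P` on the cosets of the one-parameter subgroup `t ↦ t^a` by `g`-torsion points,
for `g` invertible in `K`, on which `P` does not vanish identically. -/
def cosetZeros (P : Laurent K m) (g : ℕ) (a : Fin m → ℤ) : Set (Torus K m) :=
  {ζ | evalAt ζ P = 0 ∧ (∃ t, evalAt (ζ * cochar a t) P ≠ 0) ∧
    ∃ (η : Torus K m) (τ ω : Kˣ), η ^ g = 1 ∧ ζ = η * cochar a τ ∧ orderOf ω = g}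

/-- The pairs `(η, τ)`, with `η` a `g`-torsion point, which parametrise points `η τ^a` of
`cosetZeros P g a`. -/
def cosetZeroPairs (P : Laurent K m) (g : ℕ) (a : Fin m → ℤ) : Set (Torus K m × Kˣ) :=
  {p | p.1 ^ g = 1 ∧ evalAt (p.1 * cochar a p.2) P = 0 ∧ ∃ t, evalAt (p.1 * cochar a t) P ≠ 0}

theorem encard_cosetZeroPairs_le {P : Laurent K m} {g D : ℕ} {a : Fin m → ℤ} (hg : g ≠ 0)
    (hD : ∀ μ ∈ P.coeff.support, |a ⬝ᵥ μ| ≤ D) :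
    (cosetZeroPairs P g a).encard ≤ ↑(g ^ m * (2 * D)) := by
  have hroots := encard_setOf_pow_eq_one_le (K := K) (k := m) hg
  rw [Nat.cast_mul]
  refine (encard_le_mul_encard_of_fiber (f := Prod.fst) (fun p hp => hp.1)
    (Set.finite_of_encard_le_coe hroots) fun η _ => ?_).trans
    (mul_le_mul_left hroots ((2 * D : ℕ) : ℕ∞))
  have hinj : Set.InjOn Prod.snd {p ∈ cosetZeroPairs P g a | p.1 = η} := fun p hp q hq h =>
    Prod.ext (hp.2.trans hq.2.symm) h
  by_cases hη : ∃ t, evalAt (η * cochar a t) P ≠ 0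
  · refine (Set.encard_le_encard_of_injOn ?_ hinj).trans
      (encard_setOf_evalAt_mul_cochar_eq_zero_le hD hη)
    rintro p ⟨hp, rfl⟩
    exact hp.2.1
  · refine (Set.encard_eq_zero.2 (Set.eq_empty_of_forall_notMem ?_)).trans_le zero_le
    rintro p ⟨hp, rfl⟩
    exact hη hp.2.2

/-- Each point `η τ^a` is counted `g` times: it is parametrised by the pairs `(η ω⁻ᵃ, τ ω)` with
`ω` a `g`-th root of unity. -/
theorem encard_cosetZeros_mul_le (P : Laurent K m) (g : ℕ) (a : Fin m → ℤ) :
    (cosetZeros P g a).encard * g ≤ (cosetZeroPairs P g a).encard := by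
  choose! η τ ω hη hζ hω using fun ζ (h : ζ ∈ cosetZeros P g a) => h.2.2
  let f (p : Torus K m × ℕ) : Torus K m × Kˣ :=
    (η p.1 * (cochar a (ω p.1 ^ p.2))⁻¹, τ p.1 * ω p.1 ^ p.2)
  have hf (ζ) (h : ζ ∈ cosetZeros P g a) (j : ℕ) (t : Kˣ) :
      (f (ζ, j)).1 * cochar a (τ ζ * t * ω ζ ^ j) = ζ * cochar a t := by
    rw [mul_comm _ (ω ζ ^ j), map_mul, mul_assoc (η ζ), inv_mul_cancel_left, map_mul, ← mul_assoc,
      ← hζ ζ h]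
  have hf_one (ζ) (h : ζ ∈ cosetZeros P g a) (j : ℕ) :
      (f (ζ, j)).1 * cochar a (f (ζ, j)).2 = ζ := by
    have h1 := hf ζ h j 1
    rwa [mul_one, map_one, mul_one] at h1
  have hmaps : Set.MapsTo f (cosetZeros P g a ×ˢ ↑(Finset.range g)) (cosetZeroPairs P g a) := by
    rintro ⟨ζ, j⟩ ⟨h, -⟩
    refine ⟨?_, ?_, ?_⟩
    · have hωg : (ω ζ ^ j) ^ g = 1 := by
        rw [← pow_mul, mul_comm, pow_mul, ← hω ζ h, pow_orderOf_eq_one, one_pow]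
      rw [mul_pow, hη ζ h, inv_pow, ← map_pow, hωg, map_one, inv_one, one_mul]
    · rw [hf_one ζ h]
      exact h.1
    · obtain ⟨t, ht⟩ := h.2.1
      exact ⟨_, hf ζ h j t ▸ ht⟩
  have hinj : Set.InjOn f (cosetZeros P g a ×ˢ ↑(Finset.range g)) := by
    rintro ⟨ζ, i⟩ ⟨h, hi⟩ ⟨ζ', j⟩ ⟨h', hj⟩ heq
    obtain rfl : ζ = ζ' := by rw [← hf_one ζ h i, heq, hf_one ζ' h' j]
    have hpow : ω ζ ^ i = ω ζ ^ j := mul_left_cancel (congrArg Prod.snd heq)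
    have hij : i = j := pow_injOn_Iio_orderOf (by simpa [hω ζ h] using hi)
      (by simpa [hω ζ h] using hj) hpow
    rw [hij]
  have hle := Set.encard_le_encard_of_injOn hmaps hinj
  rwa [Set.encard_prod, Set.encard_coe_eq_coe_finsetCard, Finset.card_range] at hle

/-- The union of `cosetZeros P g a` over the box `|aᵢ| ≤ A`. -/
def boxZeros (P : Laurent K m) (g A : ℕ) : Set (Torus K m) :=
  ⋃ a ∈ Finset.Icc (fun _ => -(A : ℤ)) (fun _ => (A : ℤ)), cosetZeros P g a

theorem mem_boxZeros {P : Laurent K m} {g A : ℕ} {a : Fin m → ℤ} (ha : ∀ i, |a i| ≤ A)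
    {ζ : Torus K m} (hζ : ζ ∈ cosetZeros P g a) : ζ ∈ boxZeros P g A :=
  Set.mem_biUnion (Finset.mem_coe.2 (Finset.mem_Icc.2
    ⟨fun i => (abs_le.1 (ha i)).1, fun i => (abs_le.1 (ha i)).2⟩)) hζ

theorem encard_boxZeros_mul_le {P : Laurent K m} {D : ℕ}
    (hD : ∀ (a : Fin m → ℤ) (A : ℕ), (∀ i, |a i| ≤ A) →
      ∀ μ ∈ P.coeff.support, |a ⬝ᵥ μ| ≤ (D * A : ℕ)) {g : ℕ} (hg : g ≠ 0) (A : ℕ) :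
    (boxZeros P g A).encard * g ≤ ↑((2 * A + 1) ^ m * (g ^ m * (2 * (D * A)))) := by
  set box : Finset (Fin m → ℤ) := Finset.Icc (fun _ => -(A : ℤ)) (fun _ => (A : ℤ))
  have hbox : box.card = (2 * A + 1) ^ m := by
    rw [Pi.card_Icc]
    simp only [Int.card_Icc, Finset.prod_const, Finset.card_univ, Fintype.card_fin]
    congr 1
    omega
  have hcount (a) (ha : a ∈ box) : (cosetZeros P g a).encard * g ≤ ↑(g ^ m * (2 * (D * A))) := by
    obtain ⟨ha, ha'⟩ := Finset.mem_Icc.1 ha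
    exact (encard_cosetZeros_mul_le P g a).trans
      (encard_cosetZeroPairs_le hg (hD a A fun i => abs_le.2 ⟨ha i, ha' i⟩))
  calc (boxZeros P g A).encard * g
      ≤ (∑ a ∈ box, (cosetZeros P g a).encard) * g :=
        mul_le_mul_left (Finset.set_encard_biUnion_le _ _) (g : ℕ∞)
    _ ≤ box.card • ((g ^ m * (2 * (D * A)) : ℕ) : ℕ∞) := by
        rw [Finset.sum_mul]
        exact Finset.sum_le_card_nsmul _ _ _ hcount
    _ = ↑((2 * A + 1) ^ m * (g ^ m * (2 * (D * A)))) := by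
        rw [hbox, nsmul_eq_mul]
        push_cast
        ring

theorem finite_boxZeros (P : Laurent K m) {g : ℕ} (hg : g ≠ 0) (A : ℕ) :
    (boxZeros P g A).Finite := by
  obtain ⟨D, hD⟩ := exists_abs_dotProduct_le P
  refine Set.encard_lt_top_iff.1 ((le_mul_of_one_le_right zero_le ?_).trans_lt
    ((encard_boxZeros_mul_le hD hg A).trans_lt (ENat.natCast_lt_top _)))
  exact_mod_cast Nat.one_le_iff_ne_zero.2 hg

theorem exists_ncard_boxZeros_le (P : Laurent K m) :
    ∃ C : ℝ, 0 ≤ C ∧ ∀ (B : ℝ) (g : ℕ), 0 < g → g ≤ B →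
      ((boxZeros P g ⌊B / g⌋₊).ncard : ℝ) ≤ C * B ^ (m + 1) * (1 / (g : ℝ) ^ (2 : ℝ)) := by
  obtain ⟨D, hD⟩ := exists_abs_dotProduct_le P
  refine ⟨3 ^ m * (2 * D), by positivity, fun B g hg hgB => ?_⟩
  have hg' : (0 : ℝ) < g := Nat.cast_pos.2 hg
  have hA_one : (1 : ℝ) ≤ ⌊B / g⌋₊ := by
    rw [Nat.one_le_cast, Nat.one_le_floor_iff, one_le_div hg']
    exact hgB
  have hA_le : (⌊B / g⌋₊ : ℝ) ≤ B / g := Nat.floor_le (div_nonneg (hg'.le.trans hgB) hg'.le)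
  have hcount := encard_boxZeros_mul_le hD hg.ne' ⌊B / g⌋₊
  rw [← (finite_boxZeros P hg.ne' _).cast_ncard_eq] at hcount
  refine le_of_mul_le_mul_right ?_ hg'
  calc _ ≤ (2 * (⌊B / g⌋₊ : ℝ) + 1) ^ m * (g ^ m * (2 * (D * ⌊B / g⌋₊))) := by
        exact_mod_cast hcount
    _ ≤ (3 * (B / g)) ^ m * (g ^ m * (2 * (D * (B / g)))) := by
        have hbase : 2 * (⌊B / g⌋₊ : ℝ) + 1 ≤ 3 * (B / g) := by linarith
        exact mul_le_mul (pow_le_pow_left₀ (by positivity) hbase m) (by gcongr) (by positivity)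
          (pow_nonneg (by linarith) m)
    _ = _ := by
        rw [Real.rpow_two, mul_pow, div_pow]
        field_simp
        ring

theorem le_two_mul_rpow_mul {m N Q : ℕ} (hm : 0 < m) (hN : 0 < N) (hQ : 0 < Q)
    (hNQ : N ≤ (Q + 1) ^ m) {T : ℝ} (hNT : N ≤ T) :
    (N : ℝ) ≤ 2 * T ^ (1 - 1 / (m : ℝ)) * Q := by
  have hN' : (0 : ℝ) < N := Nat.cast_pos.2 hN
  have hroot : (N : ℝ) ^ (1 / (m : ℝ)) ≤ 2 * Q := by
    have hQ1 : (1 : ℝ) ≤ Q := mod_cast hQ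
    calc (N : ℝ) ^ (1 / (m : ℝ)) ≤ (((Q : ℝ) + 1) ^ m) ^ (1 / (m : ℝ)) := by
          gcongr
          exact_mod_cast hNQ
      _ = Q + 1 := by rw [one_div, Real.pow_rpow_inv_natCast (by positivity) hm.ne']
      _ ≤ 2 * Q := by linarith
  have hexp : 0 ≤ 1 - 1 / (m : ℝ) :=
    sub_nonneg.2 ((div_le_one (Nat.cast_pos.2 hm)).2 (mod_cast hm))
  calc (N : ℝ) = (N : ℝ) ^ (1 - 1 / (m : ℝ)) * (N : ℝ) ^ (1 / (m : ℝ)) := by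
        rw [← Real.rpow_add hN', sub_add_cancel, Real.rpow_one]
    _ ≤ T ^ (1 - 1 / (m : ℝ)) * (2 * Q) := by
        have hT : 0 ≤ T := hN'.le.trans hNT
        gcongr
    _ = 2 * T ^ (1 - 1 / (m : ℝ)) * Q := by ring

theorem exists_eq_mul_cochar_of_le (hm : 0 < m) {ζ : Torus K m} (hζ : IsOfFinOrder ζ)
    (hζ1 : ζ ≠ 1) {T : ℝ} (hT : orderOf ζ ≤ T) :
    ∃ (g : ℕ) (a : Fin m → ℤ) (η : Torus K m) (τ ω : Kˣ), 0 < g ∧ a ≠ 0 ∧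
      (∀ i, (|a i| : ℤ) * (g : ℝ) ≤ 2 * T ^ (1 - 1 / (m : ℝ))) ∧ η ^ g = 1 ∧
      ζ = η * cochar a τ ∧ orderOf ω = g := by
  have hN : 1 < orderOf ζ :=
    lt_of_le_of_ne hζ.orderOf_pos (Ne.symm (mt orderOf_eq_one_iff.1 hζ1))
  set Q := Nat.nthRoot m (orderOf ζ - 1)
  have hQ : 1 ≤ Q := (Nat.le_nthRoot_iff hm.ne').2 (by rw [one_pow]; omega)
  have hQN : Q ^ m ≤ orderOf ζ - 1 := Nat.pow_nthRoot_le_iff.2 (Or.inl hm.ne')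
  have hNQ : orderOf ζ - 1 < (Q + 1) ^ m := Nat.lt_pow_nthRoot_add_one hm.ne' _
  obtain ⟨g, a, η, τ, ω, hg, ha, ha_le, h⟩ := exists_eq_mul_cochar hζ hQ (by omega)
  refine ⟨g, a, η, τ, ω, hg, ha, fun i => ?_, h⟩
  have hai : (|a i| : ℤ) * (g : ℝ) * Q ≤ orderOf ζ := mod_cast ha_le i
  exact le_of_mul_le_mul_right (hai.trans (le_two_mul_rpow_mul hm hζ.orderOf_pos hQ (by omega) hT))
    (Nat.cast_pos.2 hQ)

/-- The zeros of `P` which do not lie on a coset of a one-parameter subgroup on which `P` vanishes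
identically. -/
def isolatedZeros (P : Laurent K m) : Set (Torus K m) :=
  {ζ | evalAt ζ P = 0 ∧ ∀ a, a ≠ 0 → ∃ t, evalAt (ζ * cochar a t) P ≠ 0}

theorem torsionUpTo_isolatedZeros_subset (hm : 0 < m) (P : Laurent K m) {T B : ℝ}
    (hB : 2 * T ^ (1 - 1 / (m : ℝ)) = B) :
    torsionUpTo (isolatedZeros P \ {1}) T ⊆ ⋃ g ∈ Finset.Icc 1 ⌊B⌋₊, boxZeros P g ⌊B / g⌋₊ := by
  rintro ζ ⟨⟨⟨hζP, hζ_iso⟩, hζ1⟩, hζ, hζT⟩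
  obtain ⟨g, a, η, τ, ω, hg, ha, ha_le, hη, hζ_eq, hω⟩ := exists_eq_mul_cochar_of_le hm hζ hζ1 hζT
  rw [hB] at ha_le
  have hg' : (0 : ℝ) < g := Nat.cast_pos.2 hg
  have hgB : (g : ℝ) ≤ B := by
    obtain ⟨i, hi⟩ := Function.ne_iff.1 ha
    have hai : (1 : ℝ) ≤ (|a i| : ℤ) := mod_cast Int.one_le_abs hi
    exact (le_mul_of_one_le_left hg'.le hai).trans (ha_le i)
  have habs (i : Fin m) : |a i| ≤ ⌊B / g⌋₊ := by
    rw [Int.abs_eq_natAbs, Nat.cast_le]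
    refine Nat.le_floor ((le_div_iff₀ hg').2 ?_)
    rw [Nat.cast_natAbs]
    exact ha_le i
  simp only [Set.mem_iUnion]
  exact ⟨g, Finset.mem_Icc.2 ⟨hg, Nat.le_floor hgB⟩,
    mem_boxZeros habs ⟨hζP, hζ_iso a ha, η, τ, ω, hη, hζ_eq, hω⟩⟩

theorem torsionBound_isolatedZeros (hm : 0 < m) (P : Laurent K m) :
    TorsionBound (isolatedZeros P) ((m : ℝ) - 1 / m) := by
  have hm' : (1 : ℝ) ≤ m := mod_cast hm
  have he : 0 ≤ (m : ℝ) - 1 / m :=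
    sub_nonneg.2 (((div_le_one (by linarith)).2 hm').trans hm')
  suffices TorsionBound (isolatedZeros P \ {1}) ((m : ℝ) - 1 / m) from
    (((torsionBound_of_finite (Set.finite_singleton 1) he)).union this).mono (by simp) le_rfl
  obtain ⟨C, hC, hcount⟩ := exists_ncard_boxZeros_le P
  refine ⟨C * 2 ^ (m + 1) * ∑' g : ℕ, 1 / (g : ℝ) ^ (2 : ℝ), fun T hT => ?_⟩
  have hT0 : 0 ≤ T := zero_le_one.trans hT
  obtain ⟨B, hB⟩ : ∃ B, 2 * T ^ (1 - 1 / (m : ℝ)) = B := ⟨_, rfl⟩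
  have hB0 : 0 ≤ B := hB ▸ by positivity
  have hB_pow : B ^ (m + 1) = 2 ^ (m + 1) * T ^ ((m : ℝ) - 1 / m) := by
    rw [← hB, mul_pow, ← Real.rpow_natCast (T ^ _), ← Real.rpow_mul hT0]
    congr 2
    push_cast
    field_simp
    ring
  calc ((torsionUpTo (isolatedZeros P \ {1}) T).ncard : ℝ)
      ≤ C * B ^ (m + 1) * ∑' g : ℕ, 1 / (g : ℝ) ^ (2 : ℝ) := by
        refine le_trans (Nat.cast_le.2 (Set.ncard_le_ncard
          (torsionUpTo_isolatedZeros_subset hm P hB) ?_)) (ncard_biUnion_Icc_le (by positivity)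
            one_lt_two fun g hg => ?_)
        · exact (Finset.finite_toSet _).biUnion fun g hg => finite_boxZeros P
            (Nat.one_le_iff_ne_zero.1 (Finset.mem_Icc.1 hg).1) _
        · exact hcount B g (Finset.mem_Icc.1 hg).1
            ((Nat.le_floor_iff hB0).1 (Finset.mem_Icc.1 hg).2)
    _ = _ := by
        rw [hB_pow]
        ring

end IsolatedPoints

section Relations

theorem linearIndependent_mkQ_comp_iff {R M ι : Type*} [Ring R] [AddCommGroup M] [Module R M]
    [Fintype ι] (N : Submodule R M) (v : ι → M) :
    LinearIndependent R (N.mkQ ∘ v) ↔ ∀ c : ι → R, ∑ j, c j • v j ∈ N → ∀ j, c j = 0 := by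
  simp only [Fintype.linearIndependent_iff, Function.comp_apply, ← map_smul, ← map_sum]
  simp only [Submodule.mkQ_apply, Submodule.Quotient.mk_eq_zero]

variable {K : Type*} [Field K] {n k : ℕ} {X : Set (Torus K n)}

/-- The lattice of exponents `m` such that `x^m` is constant on `X`. -/
def relLattice (X : Set (Torus K n)) : Submodule ℤ (Fin n → ℤ) where
  carrier := {m | ∃ c : Kˣ, ∀ x ∈ X, chr x m = c}
  zero_mem' := ⟨1, fun x _ => chr_zero x⟩
  add_mem' := by
    rintro m m' ⟨c, hc⟩ ⟨c', hc'⟩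
    exact ⟨c * c', fun x hx => by rw [chr_add, hc x hx, hc' x hx]⟩
  smul_mem' := by
    rintro z m ⟨c, hc⟩
    exact ⟨c ^ z, fun x hx => by rw [chr_smul, hc x hx]⟩

theorem mem_relLattice {m : Fin n → ℤ} :
    m ∈ relLattice X ↔ ∃ c : Kˣ, ∀ x ∈ X, chr x m = c := Iff.rfl

theorem isClosed_setOf_chr_eq (m : Fin n → ℤ) (c : Kˣ) :
    IsClosed {x : Torus K n | chr x m = c} := by
  convert isClosed_setOf_evalAt_eq_zero (AddMonoidAlgebra.single m (1 : K) - algebraMap K _ c)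
    using 1
  ext x
  simp [evalAt_single, sub_eq_zero, Units.val_inj]

theorem relLattice_closure (X : Set (Torus K n)) : relLattice (closure X) = relLattice X := by
  ext m
  exact ⟨fun ⟨c, hc⟩ => ⟨c, fun x hx => hc x (subset_closure hx)⟩,
    fun ⟨c, hc⟩ => ⟨c, fun _ hx => closure_minimal hc (isClosed_setOf_chr_eq m c) hx⟩⟩

theorem relLattice_image (B : Fin k → Fin n → ℤ) (X : Set (Torus K n)) :
    relLattice (monomialMap B '' X) =
      (relLattice X).comap (Fintype.linearCombination ℤ B) := by
  ext m
  simp [mem_relLattice, chr_monomialMap, Fintype.linearCombination_apply]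

theorem linearIndependent_mkQ_relLattice {ι : Type*} [Finite ι] {f : ι → Fin n → ℤ}
    (hf : AlgebraicIndependent K fun j => mon X (f j)) :
    LinearIndependent ℤ ((relLattice X).mkQ ∘ f) := by
  have := Fintype.ofFinite ι
  refine (linearIndependent_mkQ_comp_iff _ f).2 fun c ⟨u, hu⟩ => ?_
  let pos : ι →₀ ℕ := Finsupp.equivFunOnFinite.symm fun j => (c j).toNat
  let neg : ι →₀ ℕ := Finsupp.equivFunOnFinite.symm fun j => (-c j).toNat
  have hsplit (j : ι) : c j = pos j - neg j := (Int.toNat_sub_toNat_neg (c j)).symm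
  have hvanish : MvPolynomial.aeval (fun j => mon X (f j))
      (MvPolynomial.monomial pos 1 - MvPolynomial.monomial neg (u : K)) = 0 := by
    refine (aeval_mon_eq_zero_iff X f _).2 fun x hx => ?_
    have hprod : ∏ j, chr x (f j) ^ pos j = u * ∏ j, chr x (f j) ^ neg j := by
      rw [← hu x hx, chr_sum, ← Finset.prod_mul_distrib]
      refine Finset.prod_congr rfl fun j _ => ?_
      rw [chr_smul, hsplit, zpow_sub, zpow_natCast, zpow_natCast, inv_mul_cancel_right]
    rw [map_sub, MvPolynomial.eval_monomial, MvPolynomial.eval_monomial, one_mul,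
      Finsupp.prod_fintype _ _ (by simp), Finsupp.prod_fintype _ _ (by simp), sub_eq_zero]
    exact mod_cast congrArg Units.val hprod
  have heq : pos = neg := by
    have := sub_eq_zero.1 (hf.eq_zero_of_aeval_eq_zero _ hvanish)
    rcases (MvPolynomial.monomial_eq_monomial_iff _ _ _ _).1 this with h | h
    · exact h.1
    · exact absurd h.1 one_ne_zero
  exact fun j => by rw [hsplit, heq, sub_self]

/-- The dimension of the smallest torus coset containing `X`, when `X` is irreducible. -/
noncomputable def cosetDim (X : Set (Torus K n)) : ℕ := finrank ℤ ((Fin n → ℤ) ⧸ relLattice X)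

theorem cosetDim_add_finrank_relLattice (X : Set (Torus K n)) :
    cosetDim X + finrank ℤ (relLattice X) = n := by
  simpa [cosetDim] using (relLattice X).finrank_quotient_add_finrank

theorem cosetDim_anti {Y : Set (Torus K n)} (h : relLattice Y ≤ relLattice X) :
    cosetDim X ≤ cosetDim Y := by
  have := cosetDim_add_finrank_relLattice X
  have := cosetDim_add_finrank_relLattice Y
  have := Submodule.finrank_mono h
  omega

theorem cosetDim_closure (X : Set (Torus K n)) : cosetDim (closure X) = cosetDim X := by
  rw [cosetDim, relLattice_closure, cosetDim]

theorem tr_le_cosetDim (hX : IsIrreducible X) : tr X ≤ cosetDim X := by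
  obtain ⟨f, hf⟩ := exists_isTranscendenceBasis_mon hX
  simpa [cosetDim] using (linearIndependent_mkQ_relLattice hf.1).fintype_card_le_finrank

theorem exists_linearIndependent_snoc {f : Fin k → Fin n → ℤ}
    (hf : AlgebraicIndependent K fun j => mon X (f j)) (hk : k < cosetDim X) :
    ∃ m, LinearIndependent ℤ ((relLattice X).mkQ ∘ Fin.snoc (α := fun _ => Fin n → ℤ) f m) := by
  obtain ⟨q, hq⟩ := exists_linearIndependent_snoc_of_lt_finrank
    (linearIndependent_mkQ_relLattice hf) hk
  obtain ⟨m, rfl⟩ := (relLattice X).mkQ_surjective q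
  exact ⟨m, by rwa [Fin.comp_snoc]⟩

theorem cosetDim_image {B : Fin k → Fin n → ℤ}
    (hB : LinearIndependent ℤ ((relLattice X).mkQ ∘ B)) : cosetDim (monomialMap B '' X) = k := by
  have hbot : relLattice (monomialMap B '' X) = ⊥ := by
    rw [relLattice_image]
    exact eq_bot_iff.2 fun c hc => funext ((linearIndependent_mkQ_comp_iff _ B).1 hB c hc)
  have := cosetDim_add_finrank_relLattice (monomialMap B '' X)
  rwa [hbot, finrank_bot, add_zero] at this

end Relations

section MonomialImage

variable {K : Type*} [Field K] {n k : ℕ}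

/-- The map on coordinate rings induced by a monomial map. -/
noncomputable def coordMap (X : Set (Torus K n)) (B : Fin k → Fin n → ℤ) :
    CoordRing (monomialMap B '' X) →ₐ[K] CoordRing X :=
  Ideal.quotientMapₐ _ (pullback 1 B) fun P hP x hx => by
    rw [evalAt_pullback, one_mul]
    exact hP _ (Set.mem_image_of_mem _ hx)

theorem coordMap_mk (X : Set (Torus K n)) (B : Fin k → Fin n → ℤ) (P : Laurent K k) :
    coordMap X B (Ideal.Quotient.mk _ P) = Ideal.Quotient.mk _ (pullback 1 B P) := rfl

theorem coordMap_mon (X : Set (Torus K n)) (B : Fin k → Fin n → ℤ) (m : Fin k → ℤ) :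
    coordMap X B (mon _ m) = mon X (∑ j, m j • B j) := by
  simp [mon, coordMap_mk, pullback]

theorem coordMap_injective (X : Set (Torus K n)) (B : Fin k → Fin n → ℤ) :
    Function.Injective (coordMap X B) := by
  refine (injective_iff_map_eq_zero _).2 fun f hf => ?_
  obtain ⟨P, rfl⟩ := Ideal.Quotient.mk_surjective f
  rw [coordMap_mk, Ideal.Quotient.eq_zero_iff_mem] at hf
  rw [Ideal.Quotient.eq_zero_iff_mem]
  rintro _ ⟨x, hx, rfl⟩
  simpa only [evalAt_pullback, one_mul] using hf x hx

theorem tr_image_le (X : Set (Torus K n)) (B : Fin k → Fin n → ℤ) :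
    tr (monomialMap B '' X) ≤ tr X := by
  have := trdeg_le_of_injective (coordMap X B) (coordMap_injective X B)
  rw [← coe_tr, ← coe_tr] at this
  exact_mod_cast this

theorem isIrreducible_closure_image {X : Set (Torus K n)} (hX : IsIrreducible X)
    (B : Fin k → Fin n → ℤ) : IsIrreducible (closure (monomialMap B '' X)) :=
  (hX.image _ (continuous_monomialMap B).continuousOn).closure

end MonomialImage

section StableImages

variable {K : Type*} [Field K] {n k : ℕ}

theorem monomialMap_cochar (B : Fin k → Fin n → ℤ) (a : Fin n → ℤ) (t : Kˣ) :
    monomialMap B (cochar a t) = cochar ((Matrix.of B).mulVecLin a) t := by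
  ext j
  rw [monomialMap_apply, chr_cochar, dotProduct_comm]
  rfl

/-- Along the orbits `t ↦ t^a * x` the coefficients of a polynomial over the image are constant,
while the powers of `x^m` are multiplied by distinct characters of `t`. -/
theorem eq_zero_of_eval₂_coordMap_eq_zero [Infinite K] {X : Set (Torus K n)} {a : Fin n → ℤ}
    (hstab : ∀ t, ∀ x ∈ X, cochar a t * x ∈ X) {B : Fin k → Fin n → ℤ}
    (hB : (Matrix.of B).mulVecLin a = 0) {m : Fin n → ℤ} (hm : a ⬝ᵥ m ≠ 0)
    {p : Polynomial (CoordRing (monomialMap B '' X))}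
    (hp : p.eval₂ (coordMap X B : _ →+* CoordRing X) (mon X m) = 0) : p = 0 := by
  choose c hc using fun i => Ideal.Quotient.mk_surjective (p.coeff i)
  have hsum (x) (hx : x ∈ X) :
      ∑ i ∈ p.support, evalAt (monomialMap B x) (c i) * (chr x m : K) ^ i = 0 := by
    have hmem : ∑ i ∈ p.support, pullback 1 B (c i) * AddMonoidAlgebra.single m 1 ^ i ∈
        vanishingIdeal X := by
      rw [← Ideal.Quotient.eq_zero_iff_mem, ← hp, Polynomial.eval₂_eq_sum, Polynomial.sum, map_sum]
      exact Finset.sum_congr rfl fun i _ => by rw [← hc, map_mul, map_pow]; rfl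
    simpa only [map_sum, map_mul, map_pow, evalAt_pullback, evalAt_single, one_mul] using hmem x hx
  ext i
  rw [Polynomial.coeff_zero]
  by_contra hi
  refine hi ?_
  rw [← hc, Ideal.Quotient.eq_zero_iff_mem]
  rintro _ ⟨x, hx, rfl⟩
  have horbit (t : Kˣ) : ∑ j ∈ p.support, (evalAt (monomialMap B x) (c j) * (chr x m : K) ^ j) *
      (zpowGroupHom (a ⬝ᵥ m * j) t : Kˣ) = 0 := by
    rw [← hsum _ (hstab t x hx)]
    refine Finset.sum_congr rfl fun j _ => ?_
    rw [map_mul, monomialMap_cochar, hB, cochar_zero, one_mul, chr_mul, chr_cochar,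
      zpowGroupHom_apply, zpow_mul, zpow_natCast, Units.val_mul, Units.val_pow_eq_pow_val]
    ring
  have hzero := sum_mul_eq_zero_of_sum_mul_character_eq_zero horbit
    (v := fun j => if j = i then 1 else 0) fun j _ j' _ hjj' => by
      have : j = j' := Nat.cast_injective (mul_left_cancel₀ hm (zpowGroupHom_injective hjj'))
      rw [this]
  simpa [hi] using hzero

theorem tr_image_add_one_le [Infinite K] {X : Set (Torus K n)} (hX : IsIrreducible X)
    {a : Fin n → ℤ} (ha : a ≠ 0) (hstab : ∀ t, ∀ x ∈ X, cochar a t * x ∈ X)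
    {B : Fin k → Fin n → ℤ} (hB : (Matrix.of B).mulVecLin a = 0) :
    tr (monomialMap B '' X) + 1 ≤ tr X := by
  have := isPrime_vanishingIdeal_iff.2 hX
  have := isPrime_vanishingIdeal_iff.2 (hX.image _ (continuous_monomialMap B).continuousOn)
  let _ : Algebra (CoordRing (monomialMap B '' X)) (CoordRing X) := (coordMap X B).toAlgebra
  have : IsScalarTower K (CoordRing (monomialMap B '' X)) (CoordRing X) :=
    IsScalarTower.of_algebraMap_eq fun c => ((coordMap X B).commutes c).symm
  have : FaithfulSMul (CoordRing (monomialMap B '' X)) (CoordRing X) :=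
    (faithfulSMul_iff_algebraMap_injective _ _).2 (coordMap_injective X B)
  have htrans : Transcendental (CoordRing (monomialMap B '' X)) (mon X a) :=
    transcendental_iff.2 fun p hp => eq_zero_of_eval₂_coordMap_eq_zero hstab hB
      (dotProduct_self_eq_zero.not.2 ha) hp
  have : Algebra.Transcendental (CoordRing (monomialMap B '' X)) (CoordRing X) := ⟨⟨_, htrans⟩⟩
  have hpos := trdeg_pos (CoordRing (monomialMap B '' X)) (CoordRing X)
  have hadd := trdeg_add_eq K (CoordRing (monomialMap B '' X)) (A := CoordRing X)
  rw [← coe_tr, ← coe_tr] at hadd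
  have : ((tr (monomialMap B '' X) + 1 : ℕ) : Cardinal) ≤ tr X := by
    rw [← hadd, Nat.cast_add, Nat.cast_one]
    gcongr
    exact Cardinal.one_le_iff_pos.2 hpos
  exact Nat.cast_le.1 this

end StableImages

section Quotient

theorem finrank_comap_le {R M N : Type*} [CommRing R] [IsDomain R] [IsPrincipalIdealRing R]
    [AddCommGroup M] [Module R M] [AddCommGroup N] [Module R N] [Module.Free R N]
    [Module.Finite R N] (L : M →ₗ[R] N) (φ : M →ₗ[R] R)
    (h : ∀ m, L m = 0 → φ m = 0 → m = 0) (V : Submodule R N) :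
    finrank R (V.comap L) ≤ finrank R V + 1 := by
  let e : V.comap L →ₗ[R] V × R := (L.restrict fun _ h => h).prod (φ ∘ₗ (V.comap L).subtype)
  have he : Function.Injective e := (injective_iff_map_eq_zero e).2 fun x hx => by
    obtain ⟨hL, hφ⟩ := Prod.mk_eq_zero.1 hx
    exact Subtype.ext (h x (congrArg Subtype.val hL) hφ)
  simpa using LinearMap.finrank_le_finrank_of_injective he

variable {K : Type*} [Field K] {n k : ℕ}

/-- The exponents of the map `x ↦ (xᵢ^{a i₀} / x_{i₀}^{a i})ᵢ`. When `a i₀ ≠ 0` its kernel is,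
up to finite index, the one-parameter subgroup of direction `a`. -/
def quotMatrix (a : Fin n → ℤ) (i₀ : Fin n) : Fin n → Fin n → ℤ :=
  fun i => Pi.single i (a i₀) - Pi.single i₀ (a i)

theorem monomialMap_quotMatrix (a : Fin n → ℤ) (i₀ i : Fin n) (x : Torus K n) :
    monomialMap (quotMatrix a i₀) x i = x i ^ a i₀ / x i₀ ^ a i := by
  rw [monomialMap_apply, quotMatrix, chr_sub, chr_single, chr_single]

theorem quotMatrix_mulVecLin (a b : Fin n → ℤ) (i₀ i : Fin n) :
    (Matrix.of (quotMatrix a i₀)).mulVecLin b i = a i₀ * b i - a i * b i₀ := by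
  change (Pi.single i (a i₀) - Pi.single i₀ (a i)) ⬝ᵥ b = _
  rw [sub_dotProduct, single_dotProduct, single_dotProduct]

theorem quotMatrix_mulVecLin_self (a : Fin n → ℤ) (i₀ : Fin n) :
    (Matrix.of (quotMatrix a i₀)).mulVecLin a = 0 :=
  funext fun i => by rw [quotMatrix_mulVecLin, Pi.zero_apply, mul_comm, sub_self]

theorem linearCombination_quotMatrix (a c : Fin n → ℤ) (i₀ : Fin n) {i : Fin n} (hi : i ≠ i₀) :
    Fintype.linearCombination ℤ (quotMatrix a i₀) c i = c i * a i₀ := by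
  simp [Fintype.linearCombination_apply, quotMatrix, Finset.sum_apply, Pi.single_apply, hi,
    mul_sub]

theorem cosetDim_le_cosetDim_quot_add_one (X : Set (Torus K n)) {a : Fin n → ℤ} {i₀ : Fin n}
    (ha : a i₀ ≠ 0) : cosetDim X ≤ cosetDim (monomialMap (quotMatrix a i₀) '' X) + 1 := by
  have hrel := finrank_comap_le (Fintype.linearCombination ℤ (quotMatrix a i₀))
    (LinearMap.proj i₀) (fun c hc hc₀ => funext fun i => ?_) (relLattice X)
  · rw [← relLattice_image] at hrel
    have := cosetDim_add_finrank_relLattice X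
    have := cosetDim_add_finrank_relLattice (monomialMap (quotMatrix a i₀) '' X)
    omega
  · rcases eq_or_ne i i₀ with rfl | hi
    · exact hc₀
    · have := congrFun hc i
      rw [linearCombination_quotMatrix a c i₀ hi] at this
      exact (mul_eq_zero.1 this).resolve_right ha

theorem finrank_le_finrank_map_quotMatrix_add_one (V : Submodule ℤ (Fin n → ℤ)) {a : Fin n → ℤ}
    {i₀ : Fin n} (ha : a i₀ ≠ 0) :
    finrank ℤ V ≤ finrank ℤ (V.map (Matrix.of (quotMatrix a i₀)).mulVecLin) + 1 := by
  refine (Submodule.finrank_mono (Submodule.le_comap_map _ V)).trans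
    (finrank_comap_le _ (LinearMap.proj i₀) (fun b hb hb₀ => funext fun i => ?_) _)
  have := congrFun hb i
  rw [quotMatrix_mulVecLin, show b i₀ = 0 from hb₀, mul_zero, sub_zero] at this
  exact (mul_eq_zero.1 this).resolve_left ha

theorem encard_setOf_monomialMap_quotMatrix_eq_le {a : Fin n → ℤ} {i₀ : Fin n} (ha : a i₀ ≠ 0)
    (y : Torus K n) (u : Kˣ) :
    {x : Torus K n | monomialMap (quotMatrix a i₀) x = y ∧ x i₀ = u}.encard ≤
      ↑((a i₀).natAbs ^ n) := by
  rcases Set.eq_empty_or_nonempty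
    {x : Torus K n | monomialMap (quotMatrix a i₀) x = y ∧ x i₀ = u} with h | ⟨x₀, rfl, rfl⟩
  · simp [h]
  refine (Set.encard_le_encard_of_injOn (f := fun x => x / x₀)
    (t := {x | x ^ (a i₀).natAbs = 1}) (fun x hx => funext fun i => ?_)
    fun x _ x' _ h => div_left_injective h).trans
    (encard_setOf_pow_eq_one_le (Int.natAbs_ne_zero.2 ha))
  have hi : x i ^ a i₀ = x₀ i ^ a i₀ := by
    simpa only [monomialMap_quotMatrix, hx.2, div_left_inj] using congrFun hx.1 i
  simp [pow_natAbs_eq_one, div_zpow, hi]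

end Quotient

section QuotientCount

variable {K : Type*} [Field K] {n k : ℕ} {X : Set (Torus K n)}

/-- The torsion points `x` of order at most `T` on `X` such that `q` divides the order of `x` by
`g`. -/
def torsionSlice (X : Set (Torus K n)) (q : Torus K n →* Torus K k) (T : ℝ) (g : ℕ) :
    Set (Torus K n) :=
  {x ∈ torsionUpTo X T | orderOf x = g * orderOf (q x)}

theorem torsionUpTo_subset_biUnion_torsionSlice (X : Set (Torus K n))
    (q : Torus K n →* Torus K k) (T : ℝ) :
    torsionUpTo X T ⊆ ⋃ g ∈ Finset.Icc 1 ⌊T⌋₊, torsionSlice X q T g := by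
  intro x hx
  obtain ⟨g, hg⟩ := orderOf_map_dvd q x
  have hpos := hg ▸ hx.2.1.orderOf_pos
  have hg_le : g ≤ orderOf x := hg ▸ Nat.le_mul_of_pos_left g (Nat.pos_of_mul_pos_right hpos)
  simp only [Set.mem_iUnion]
  exact ⟨g, Finset.mem_Icc.2 ⟨Nat.pos_of_mul_pos_left hpos,
    Nat.le_floor ((Nat.cast_le.2 hg_le).trans hx.2.2)⟩, hx, hg.trans (mul_comm _ _)⟩

theorem encard_torsionSlice_le {q : Torus K n →* Torus K k} {i₀ : Fin n} {C : ℕ}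
    (hq : ∀ y u, {x | q x = y ∧ x i₀ = u}.encard ≤ C) {T : ℝ} {g : ℕ} (hg : 0 < g) :
    (torsionSlice X q T g).encard ≤
      (torsionUpTo (q '' X) (T / g)).encard * ↑(⌊T⌋₊ * C) := by
  have hg' : (0 : ℝ) < g := Nat.cast_pos.2 hg
  have hmaps : Set.MapsTo q (torsionSlice X q T g) (torsionUpTo (q '' X) (T / g)) := fun x hx =>
    ⟨Set.mem_image_of_mem q hx.1.1, q.isOfFinOrder hx.1.2.1,
      (le_div_iff₀' hg').2 (mod_cast hx.2 ▸ hx.1.2.2)⟩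
  refine encard_le_mul_encard_of_fiber hmaps (finite_torsionUpTo _ _) fun y hy => ?_
  have hN : g * orderOf y ≠ 0 := (Nat.mul_pos hg hy.2.1.orderOf_pos).ne'
  have hNT : g * orderOf y ≤ ⌊T⌋₊ := by
    refine Nat.le_floor ?_
    exact_mod_cast (le_div_iff₀' hg').1 hy.2.2
  have hroots : {u : Torus K 1 | u ^ (g * orderOf y) = 1}.encard ≤ ⌊T⌋₊ :=
    (encard_setOf_pow_eq_one_le hN).trans (by rw [pow_one]; exact_mod_cast hNT)
  rw [Nat.cast_mul]
  refine (encard_le_mul_encard_of_fiber (f := fun x _ => x i₀) ?_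
    (Set.finite_of_encard_le_coe hroots) fun u _ => ?_).trans (mul_le_mul_left hroots _)
  · rintro x ⟨hx, rfl⟩
    exact funext fun _ => congrFun (hx.2 ▸ pow_orderOf_eq_one x) i₀
  · refine (Set.encard_le_encard ?_).trans (hq y (u 0))
    rintro x ⟨⟨-, hxy⟩, hxu⟩
    exact ⟨hxy, congrFun hxu 0⟩

theorem TorsionBound.of_image {q : Torus K n →* Torus K k} {i₀ : Fin n} {C : ℕ}
    (hq : ∀ y u, {x | q x = y ∧ x i₀ = u}.encard ≤ C) {e : ℝ} (he : 1 < e)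
    (h : TorsionBound (q '' X) e) : TorsionBound X (e + 1) := by
  obtain ⟨D, hD⟩ := h
  have hD0 : 0 ≤ D := by simpa using (Nat.cast_nonneg _).trans (hD 1 le_rfl)
  refine ⟨D * C * ∑' g : ℕ, 1 / (g : ℝ) ^ e, fun T hT => ?_⟩
  have hT0 : 0 < T := one_pos.trans_le hT
  have hfin (g) : (torsionSlice X q T g).Finite :=
    (finite_torsionUpTo X T).subset (Set.sep_subset _ _)
  have hslice : ∀ g ∈ Finset.Icc 1 ⌊T⌋₊,
      ((torsionSlice X q T g).ncard : ℝ) ≤ D * C * T ^ (e + 1) * (1 / (g : ℝ) ^ e) := by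
    intro g hg
    obtain ⟨hg0, hgT⟩ := Finset.mem_Icc.1 hg
    have hg' : (0 : ℝ) < g := Nat.cast_pos.2 hg0
    have hcount := encard_torsionSlice_le (X := X) hq (T := T) hg0
    rw [← (hfin g).cast_ncard_eq, ← (finite_torsionUpTo _ _).cast_ncard_eq] at hcount
    calc ((torsionSlice X q T g).ncard : ℝ)
        ≤ (torsionUpTo (q '' X) (T / g)).ncard * (⌊T⌋₊ * C) := by exact_mod_cast hcount
      _ ≤ D * (T / g) ^ e * (T * C) := by
          gcongr
          · exact hD _ ((one_le_div hg').2 ((Nat.le_floor_iff hT0.le).1 hgT))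
          · exact Nat.floor_le hT0.le
      _ = D * C * T ^ (e + 1) * (1 / (g : ℝ) ^ e) := by
          rw [Real.div_rpow hT0.le hg'.le, Real.rpow_add hT0, Real.rpow_one]
          ring
  calc ((torsionUpTo X T).ncard : ℝ)
      ≤ D * C * T ^ (e + 1) * ∑' g : ℕ, 1 / (g : ℝ) ^ e :=
        le_trans (Nat.cast_le.2 (Set.ncard_le_ncard (torsionUpTo_subset_biUnion_torsionSlice X q T)
          ((Finset.finite_toSet _).biUnion fun g _ => hfin g)))
          (ncard_biUnion_Icc_le (by positivity) he hslice)
    _ = _ := by ring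

end QuotientCount

section Characters

variable {K : Type*} [Field K] {n : ℕ}

/-- The character `x ↦ x^m` as a group homomorphism. -/
def chrHom (m : Fin n → ℤ) : Torus K n →* Kˣ := MonoidHom.mk' (chr · m) (chr_mul · · m)

theorem chrHom_apply (m : Fin n → ℤ) (x : Torus K n) : chrHom m x = chr x m := rfl

theorem chrHom_injective [Infinite K] :
    Function.Injective (chrHom : (Fin n → ℤ) → Torus K n →* Kˣ) := by
  refine fun m m' h => funext fun i => zpowGroupHom_injective (K := K) (MonoidHom.ext fun t => ?_)
  simpa [chrHom_apply, chr_cochar] using DFunLike.congr_fun h (cochar (Pi.single i 1) t)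

theorem vanishingIdeal_univ [Infinite K] :
    vanishingIdeal (Set.univ : Set (Torus K n)) = ⊥ := by
  refine eq_bot_iff.2 fun P hP => AddMonoidAlgebra.coeff_injective (Finsupp.ext fun m => ?_)
  by_cases hm : m ∈ P.coeff.support
  · have := sum_mul_eq_zero_of_sum_mul_character_eq_zero (s := P.coeff.support) (c := P.coeff)
      (χ := chrHom) (fun x => (evalAt_eq_sum x P).symm.trans (hP x trivial))
      (v := fun m' => if m' = m then 1 else 0) fun i _ j _ hij => by rw [chrHom_injective hij]
    simp only [mul_ite, mul_one, mul_zero, Finset.sum_ite_eq', if_pos hm] at this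
    exact this
  · simpa using hm

theorem mem_of_forall_chr_eq_one {S : Submonoid (Torus K n)} (hS : IsClosed (S : Set (Torus K n)))
    {z : Torus K n} (hz : ∀ m : Fin n → ℤ, (∀ g ∈ S, chr g m = 1) → chr z m = 1) : z ∈ S := by
  rw [← SetLike.mem_coe, ← zeroLocus_vanishingIdeal hS]
  intro P hP
  rw [evalAt_eq_sum]
  refine sum_mul_eq_zero_of_sum_mul_character_eq_zero (χ := fun m => (chrHom m).comp S.subtype)
    (fun g => (evalAt_eq_sum (g : Torus K n) P).symm.trans (hP g g.2)) fun m _ m' _ h => ?_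
  have hquot : chr z (m - m') = 1 := hz _ fun g hg => by
    rw [chr_sub, div_eq_one]
    exact DFunLike.congr_fun h ⟨g, hg⟩
  rw [chr_sub, div_eq_one] at hquot
  rw [hquot]

end Characters

section Irreducibility

open scoped Pointwise

variable {K : Type*} [Field K] {n : ℕ}

theorem isIrreducible_mul {Y Z : Set (Torus K n)} (hY : IsIrreducible Y) (hZ : IsIrreducible Z) :
    IsIrreducible (Y * Z) := by
  refine ⟨hY.1.mul hZ.1, ?_⟩
  rintro U V hU hV ⟨_, ⟨y, hy, z, hz, rfl⟩, hyzU⟩ ⟨_, ⟨y', hy', z', hz', rfl⟩, hyzV⟩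
  obtain ⟨w, hwY, hwU, hwV⟩ := hY.2 _ _ (hU.preimage (continuous_mul_left_torus z))
    (hV.preimage (continuous_mul_left_torus z')) ⟨y, hy, by rwa [Set.mem_preimage, mul_comm]⟩
    ⟨y', hy', by rwa [Set.mem_preimage, mul_comm]⟩
  obtain ⟨u, huZ, huU, huV⟩ := hZ.2 _ _ (hU.preimage (continuous_mul_left_torus w))
    (hV.preimage (continuous_mul_left_torus w)) ⟨z, hz, by rwa [Set.mem_preimage, mul_comm]⟩
    ⟨z', hz', by rwa [Set.mem_preimage, mul_comm]⟩
  exact ⟨w * u, Set.mul_mem_mul hwY huZ, huU, huV⟩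

variable [Infinite K]

theorem isIrreducible_univ_torus : IsIrreducible (Set.univ : Set (Torus K n)) :=
  isPrime_vanishingIdeal_iff.1 (vanishingIdeal_univ (K := K) ▸ Ideal.isPrime_bot)

theorem isIrreducible_range_monomialMap {k : ℕ} (B : Fin k → Fin n → ℤ) :
    IsIrreducible (Set.range (monomialMap (K := K) B)) :=
  Set.image_univ ▸ isIrreducible_univ_torus.image _ (continuous_monomialMap B).continuousOn

theorem isIrreducible_range_cochar (a : Fin n → ℤ) :
    IsIrreducible (Set.range (cochar (K := K) a)) := by
  convert isIrreducible_range_monomialMap (K := K) (n := 1) fun i _ => a i using 1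
  rw [← (Equiv.funUnique (Fin 1) Kˣ).surjective.range_comp (cochar a)]
  congr 1
  ext x i
  simp [cochar_apply, monomialMap_apply, chr]

theorem tr_univ : tr (Set.univ : Set (Torus K n)) = n := by
  have hind : AlgebraicIndependent K fun j : Fin n =>
      mon (Set.univ : Set (Torus K n)) (Pi.single j 1) := by
    refine algebraicIndependent_iff.2 fun p hp => ?_
    refine MvPolynomial.funext_set (fun _ => {0}ᶜ)
      (fun _ => (Set.finite_singleton 0).infinite_compl)
      fun x hx => ?_
    have hx0 (i : Fin n) : x i ≠ 0 := hx i trivial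
    have := (aeval_mon_eq_zero_iff _ _ p).1 hp (fun i => Units.mk0 (x i) (hx0 i)) trivial
    simpa only [chr_single, zpow_one, Units.val_mk0, map_zero] using this
  have hge := hind.lift_cardinalMk_le_trdeg
  rw [← coe_tr, Cardinal.mk_fin, Cardinal.lift_natCast, Cardinal.lift_natCast, Nat.cast_le] at hge
  have := tr_le_cosetDim (isIrreducible_univ_torus (K := K) (n := n))
  have := cosetDim_add_finrank_relLattice (Set.univ : Set (Torus K n))
  omega

theorem tr_lt_of_mem_vanishingIdeal {X : Set (Torus K n)} (hX : IsIrreducible X)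
    {P : Laurent K n} (hP : P ≠ 0) (hPX : P ∈ vanishingIdeal X) : tr X < n := by
  rw [← tr_closure]
  refine (tr_lt_of_ssubset isClosed_univ isIrreducible_univ_torus isClosed_closure hX.closure
    (Set.ssubset_univ_iff.2 fun h => hP ?_)).trans_eq tr_univ
  rwa [← vanishingIdeal_closure, h, vanishingIdeal_univ, Ideal.mem_bot] at hPX

theorem exists_ne_zero_mem_vanishingIdeal {X : Set (Torus K n)} (h : tr X < n) :
    ∃ P : Laurent K n, P ≠ 0 ∧ P ∈ vanishingIdeal X := by
  by_contra! hX
  have hbot : vanishingIdeal (closure X) = vanishingIdeal Set.univ := by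
    rw [vanishingIdeal_closure, vanishingIdeal_univ]
    exact eq_bot_iff.2 fun P hP => by_contra fun hP0 => hX P hP0 hP
  have huniv := eq_of_vanishingIdeal_eq isClosed_closure isClosed_univ hbot
  rw [← tr_closure, huniv, tr_univ] at h
  exact h.false

/-- The closure of the union of the translates is irreducible, contains `Y`, and is not the whole
torus. -/
theorem cochar_mul_mem_of_forall_evalAt_eq_zero {Y : Set (Torus K n)} (hY : IsClosed Y)
    (hirr : IsIrreducible Y) (hn : n ≤ tr Y + 1) {P : Laurent K n} (hP : P ≠ 0)
    {a : Fin n → ℤ} (hPY : ∀ y ∈ Y, ∀ t, evalAt (y * cochar a t) P = 0) (t : Kˣ)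
    {y : Torus K n} (hy : y ∈ Y) : cochar a t * y ∈ Y := by
  have hW := isIrreducible_mul hirr (isIrreducible_range_cochar a)
  have htr : tr (Y * Set.range (cochar a)) < n := by
    refine tr_lt_of_mem_vanishingIdeal hW hP ?_
    rintro _ ⟨y, hy, _, ⟨t, rfl⟩, rfl⟩
    exact hPY y hy t
  have hYW : Y ⊆ closure (Y * Set.range (cochar a)) := fun y hy =>
    subset_closure ⟨y, hy, 1, ⟨1, map_one _⟩, mul_one y⟩
  rw [eq_of_subset_of_tr_le isClosed_closure hW.closure hY hirr hYW (by rw [tr_closure]; omega)]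
  exact subset_closure ⟨y, hy, _, ⟨t, rfl⟩, mul_comm _ _⟩

end Irreducibility

section TorsionCosets

variable {K : Type*} [Field K] {n : ℕ}

/-- The algebraic subgroup of the points on which all characters in `M` are trivial. -/
def latticeSubgroup (K : Type*) [Field K] (M : Submodule ℤ (Fin n → ℤ)) : Subgroup (Torus K n) :=
  ⨅ m ∈ M, (chrHom m).ker

theorem mem_latticeSubgroup {M : Submodule ℤ (Fin n → ℤ)} {x : Torus K n} :
    x ∈ latticeSubgroup K M ↔ ∀ m ∈ M, chr x m = 1 := by
  simp [latticeSubgroup, Subgroup.mem_iInf, MonoidHom.mem_ker, chrHom_apply]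

theorem isClosed_latticeSubgroup (M : Submodule ℤ (Fin n → ℤ)) :
    IsClosed (latticeSubgroup K M : Set (Torus K n)) := by
  simp only [latticeSubgroup, Subgroup.coe_iInf]
  exact isClosed_biInter fun m _ => isClosed_setOf_chr_eq m 1

theorem exists_latticeSubgroup_eq_range (M : Submodule ℤ (Fin n → ℤ))
    [IsTorsionFree ℤ ((Fin n → ℤ) ⧸ M)] :
    ∃ (r : ℕ) (B : Fin n → Fin r → ℤ), latticeSubgroup K M = (monomialMap B).range := by
  let b := finBasis ℤ ((Fin n → ℤ) ⧸ M)
  let B (j : Fin n) : Fin (finrank ℤ ((Fin n → ℤ) ⧸ M)) → ℤ := b.equivFun (M.mkQ (Pi.single j 1))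
  have hB (m : Fin n → ℤ) : ∑ j, m j • B j = b.equivFun (M.mkQ m) := by
    simp only [B, ← map_smul, ← map_sum, ← Pi.single_smul', smul_eq_mul, mul_one,
      Finset.univ_sum_single]
  refine ⟨_, B, le_antisymm (fun x hx => ?_) ?_⟩
  · choose v hv using fun i => M.mkQ_surjective (b i)
    refine ⟨fun i => chr x (v i), funext fun j => ?_⟩
    have hmem : (Pi.single j 1 : Fin n → ℤ) - ∑ i, B j i • v i ∈ M := by
      rw [← Submodule.Quotient.mk_eq_zero, ← Submodule.mkQ_apply, map_sub, map_sum, sub_eq_zero]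
      simp only [map_smul, hv]
      exact (b.sum_equivFun _).symm
    have hx1 := mem_latticeSubgroup.1 hx _ hmem
    rw [chr_sub, div_eq_one, chr_single, zpow_one, chr_sum] at hx1
    simp only [hx1, monomialMap_apply, chr_smul]
    rfl
  · rintro _ ⟨t, rfl⟩
    refine mem_latticeSubgroup.2 fun m hm => ?_
    rw [chr_monomialMap, hB, Submodule.mkQ_apply, (Submodule.Quotient.mk_eq_zero M).2 hm, map_zero,
      chr_zero]

variable {X : Set (Torus K n)}

/-- An irreducible set covered by finitely many closed sets `{x | x^m = u}` lies in one of them. -/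
theorem mem_relLattice_of_forall_isRoot (hX : IsIrreducible X) {m : Fin n → ℤ} {p : Polynomial K}
    (hp : p ≠ 0) (h : ∀ x ∈ X, p.IsRoot (chr x m)) : m ∈ relLattice X := by
  classical
  have hfin : {u : Kˣ | p.IsRoot u}.Finite :=
    (p.finite_setOfPred_isRoot hp).preimage Units.val_injective.injOn
  obtain ⟨Z, hZ, hXZ⟩ := isIrreducible_iff_sUnion_isClosed.1 hX
    (hfin.toFinset.image fun u => {x | chr x m = u})
    (by simpa using fun u _ => isClosed_setOf_chr_eq m u)
    fun x hx => ⟨_, Finset.mem_image_of_mem _ (hfin.mem_toFinset.2 (h x hx)), rfl⟩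
  obtain ⟨u, -, rfl⟩ := Finset.mem_image.1 hZ
  exact ⟨u, hXZ⟩

theorem isTorsionFree_quotient_relLattice (hX : IsIrreducible X) :
    IsTorsionFree ℤ ((Fin n → ℤ) ⧸ relLattice X) := by
  refine .of_smul_eq_zero fun k q hkq => or_iff_not_imp_left.2 fun hk => ?_
  obtain ⟨m, rfl⟩ := (relLattice X).mkQ_surjective q
  have hmem : k.natAbs • m ∈ relLattice X := by
    rw [← natCast_zsmul, ← (relLattice X).ker_mkQ, LinearMap.mem_ker, map_smul]
    rcases k.natAbs_eq with h | h <;> rw [h] at hkq <;> simpa using hkq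
  obtain ⟨c, hc⟩ := hmem
  refine (Submodule.Quotient.mk_eq_zero _).2 (mem_relLattice_of_forall_isRoot hX
    (Polynomial.X_pow_sub_C_ne_zero (Int.natAbs_pos.2 hk) (c : K)) fun x hx => ?_)
  rw [Polynomial.IsRoot, Polynomial.eval_sub, Polynomial.eval_C, Polynomial.eval_X_pow, sub_eq_zero,
    ← hc x hx, ← natCast_zsmul, chr_smul, zpow_natCast, Units.val_pow_eq_pow_val]

theorem tr_pos_of_lt_cosetDim (hX : IsIrreducible X) (h : tr X < cosetDim X) : 0 < tr X := by
  have := isPrime_vanishingIdeal_iff.2 hX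
  by_contra! h0
  have halg : Algebra.IsAlgebraic K (CoordRing X) :=
    trdeg_eq_zero_iff.1 (by rw [← coe_tr, Nat.le_zero.1 h0, Nat.cast_zero])
  have htop : relLattice X = ⊤ := Submodule.eq_top_iff'.2 fun m => by
    obtain ⟨p, hp, hpm⟩ := halg.isAlgebraic (mon X m)
    have hmem : Polynomial.aeval (AddMonoidAlgebra.single m (1 : K)) p ∈ vanishingIdeal X := by
      rw [← Ideal.Quotient.eq_zero_iff_mem, ← hpm]
      exact (Polynomial.aeval_algHom_apply (Ideal.Quotient.mkₐ K (vanishingIdeal X)) _ p).symm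
    refine mem_relLattice_of_forall_isRoot hX hp fun x hx => ?_
    simpa [← Polynomial.aeval_algHom_apply, evalAt_single, Polynomial.aeval_def] using hmem x hx
  have := cosetDim_add_finrank_relLattice X
  rw [htop, finrank_top, finrank_fin_fun] at this
  omega

variable [Infinite K]

theorem isTorsionCoset_of_cosetDim_le_tr (hX : IsClosed X) (hirr : IsIrreducible X)
    (hle : cosetDim X ≤ tr X) {ζ : Torus K n} (hζX : ζ ∈ X) (hζ : IsOfFinOrder ζ) :
    IsTorsionCoset X := by
  have := isTorsionFree_quotient_relLattice hirr
  set G := latticeSubgroup K (relLattice X)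
  have hGi : IsIrreducible (G : Set (Torus K n)) := by
    obtain ⟨r, B, hB⟩ := exists_latticeSubgroup_eq_range (K := K) (relLattice X)
    rw [show G = _ from hB]
    exact isIrreducible_range_monomialMap B
  have hGc := isClosed_latticeSubgroup (K := K) (relLattice X)
  have hCi : IsIrreducible ((fun g => ζ * g) '' (G : Set (Torus K n))) :=
    hGi.image _ (continuous_mul_left_torus ζ).continuousOn
  have hrel : relLattice X ≤ relLattice ((fun g => ζ * g) '' (G : Set (Torus K n))) := by
    refine fun m hm => ⟨chr ζ m, ?_⟩
    rintro _ ⟨g, hg, rfl⟩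
    exact (chr_mul ζ g m).trans (by rw [mem_latticeSubgroup.1 hg m hm, mul_one])
  have hXC : X ⊆ (fun g => ζ * g) '' (G : Set (Torus K n)) := by
    refine fun x hx => ⟨ζ⁻¹ * x, mem_latticeSubgroup.2 fun m ⟨c, hc⟩ => ?_, mul_inv_cancel_left ζ x⟩
    have : chr (ζ * (ζ⁻¹ * x)) m = chr ζ m := by rw [mul_inv_cancel_left, hc x hx, hc ζ hζX]
    exact mul_eq_left.1 ((chr_mul _ _ m).symm.trans this)
  exact ⟨ζ, G, hζ, ⟨isAlgebraicSet_of_isClosed hGc, hGi⟩,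
    eq_of_subset_of_tr_le ((translate ζ).isClosedMap _ hGc) hCi hX hirr hXC
      ((tr_le_cosetDim hCi).trans ((cosetDim_anti hrel).trans hle))⟩

end TorsionCosets

section Exponent

/-- The exponent `d + 1 - 1 / (d - δ + 1)` of the bound for sets of dimension `d` with a stabilizer
of dimension `δ`. -/
noncomputable def boundExponent (d δ : ℕ) : ℝ := (d : ℝ) + 1 - 1 / ((d : ℝ) - δ + 1)

variable {d d' δ δ' : ℕ}

theorem le_boundExponent (h : δ ≤ d) : (d : ℝ) ≤ boundExponent d δ := by
  have hδ : (δ : ℝ) ≤ d := Nat.cast_le.2 h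
  have : 1 / ((d : ℝ) - δ + 1) ≤ 1 := (div_le_one (by linarith)).2 (by linarith)
  unfold boundExponent
  linarith

theorem one_lt_boundExponent (h : δ < d) : 1 < boundExponent d δ := by
  have hδ : (δ : ℝ) + 1 ≤ d := mod_cast h
  have : 1 / ((d : ℝ) - δ + 1) < 1 := (div_lt_one (by linarith)).2 (by linarith)
  have : (1 : ℝ) ≤ d := mod_cast (Nat.zero_le δ).trans_lt h
  unfold boundExponent
  linarith

theorem boundExponent_mono_left (h : δ ≤ d) (hd : d ≤ d') :
    boundExponent d δ ≤ boundExponent d' δ := by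
  have hδ : (δ : ℝ) ≤ d := Nat.cast_le.2 h
  have hd : (d : ℝ) ≤ d' := Nat.cast_le.2 hd
  unfold boundExponent
  gcongr

theorem boundExponent_add_one_le (h : δ ≤ d) (hd : d + 1 ≤ d') (hδ' : δ' ≤ δ + 1) :
    boundExponent d δ + 1 ≤ boundExponent d' δ' := by
  have hδ : (δ : ℝ) ≤ d := Nat.cast_le.2 h
  have hd : (d : ℝ) + 1 ≤ d' := mod_cast hd
  have hδ' : (δ' : ℝ) ≤ δ + 1 := mod_cast hδ'
  have : 1 / ((d' : ℝ) - δ' + 1) ≤ 1 / ((d : ℝ) - δ + 1) :=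
    one_div_le_one_div_of_le (by linarith) (by linarith)
  unfold boundExponent
  linarith

end Exponent

section PowerSaving

variable {K : Type*} [Field K] {n : ℕ} {X : Set (Torus K n)}

theorem TorsionBound.of_image_quotMatrix {a : Fin n → ℤ} {i₀ : Fin n} (ha : a i₀ ≠ 0)
    {d d' δ δ' : ℕ} (hδ : δ < d) (hd : d + 1 ≤ d') (hδ' : δ' ≤ δ + 1)
    (h : TorsionBound (monomialMap (quotMatrix a i₀) '' X) (boundExponent d δ)) :
    TorsionBound X (boundExponent d' δ') :=
  (TorsionBound.of_image (encard_setOf_monomialMap_quotMatrix_eq_le ha)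
    (one_lt_boundExponent hδ) h).mono subset_rfl (boundExponent_add_one_le hδ.le hd hδ')

theorem le_tr_image {k l : ℕ} (B : Fin l → Fin n → ℤ) (g : Fin k → Fin l)
    (h : AlgebraicIndependent K fun j => mon X (B (g j))) : k ≤ tr (monomialMap B '' X) := by
  have hind : AlgebraicIndependent K fun j => mon (monomialMap B '' X) (Pi.single (g j) 1) := by
    refine .of_comp (coordMap X B) ?_
    convert h with j
    rw [Function.comp_apply, coordMap_mon, Fintype.sum_eq_single (g j) fun i hi => by simp [hi],
      Pi.single_eq_same, one_smul]
  have := hind.lift_cardinalMk_le_trdeg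
  rwa [← coe_tr, Cardinal.mk_fin, Cardinal.lift_natCast, Cardinal.lift_natCast, Nat.cast_le] at this

theorem isClosed_setOf_forall_evalAt_mul_cochar_eq_zero (P : Laurent K n) (a : Fin n → ℤ) :
    IsClosed {y : Torus K n | ∀ t, evalAt (y * cochar a t) P = 0} := by
  rw [Set.ofPred_forall]
  refine isClosed_iInter fun t => ?_
  simp only [mul_comm _ (cochar a t)]
  exact (isClosed_setOf_evalAt_eq_zero P).preimage (continuous_mul_left_torus _)

theorem torsionBound_of_hypersurface (hX : IsClosed X) (hirr : IsIrreducible X)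
    (hlt : tr X < cosetDim X) {e : ℝ} (he : tr X ≤ e)
    (h : ∀ Y : Set (Torus K (tr X + 1)), IsClosed Y → IsIrreducible Y → tr Y = tr X →
      cosetDim Y = tr X + 1 → TorsionBound Y e) : TorsionBound X e := by
  obtain ⟨f, hf⟩ := exists_isTranscendenceBasis_mon hirr
  obtain ⟨m, hm⟩ := exists_linearIndependent_snoc hf.1 hlt
  set B : Fin (tr X + 1) → Fin n → ℤ := Fin.snoc (α := fun _ => Fin n → ℤ) f m
  have hBf (j : Fin (tr X)) : B j.castSucc = f j := Fin.snoc_castSucc ..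
  have hY : TorsionBound (closure (monomialMap B '' X)) e := by
    refine h _ isClosed_closure (isIrreducible_closure_image hirr B) ?_ ?_
    · rw [tr_closure]
      exact (tr_image_le X B).antisymm (le_tr_image B Fin.castSucc (by simpa only [hBf] using hf.1))
    · rw [cosetDim_closure, cosetDim_image hm]
  obtain ⟨Z, hZX, hZ, C, hC⟩ := exists_ssubset_forall_encard_fiber_le hX hirr hf
  have hXZ : TorsionBound (X \ Z) e := by
    refine .of_fiber (monomialMap B) (fun x hx => subset_closure (Set.mem_image_of_mem _ hx.1))
      (fun y => (Set.encard_le_encard ?_).trans (hC fun j => y j.castSucc)) hY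
    rintro x ⟨hx, rfl⟩
    exact ⟨hx, funext fun j => by rw [monomialMap_apply, monomialMap_apply, hBf]⟩
  exact (hXZ.union ((torsionBound_of_ssubset hX hirr hZ hZX).mono subset_rfl he)).mono
    (Set.sdiff_union_of_subset hZX.subset).ge le_rfl

variable [Infinite K]

theorem tr_lt_cosetDim_image_quotMatrix (hX : IsIrreducible X) (h : tr X < cosetDim X)
    {a : Fin n → ℤ} {i₀ : Fin n} (ha : a i₀ ≠ 0) (hstab : ∀ t, ∀ x ∈ X, cochar a t * x ∈ X) :
    tr (monomialMap (quotMatrix a i₀) '' X) < cosetDim (monomialMap (quotMatrix a i₀) '' X) := by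
  have := tr_image_add_one_le hX (Function.ne_iff.2 ⟨i₀, ha⟩) hstab
    (quotMatrix_mulVecLin_self a i₀)
  have := cosetDim_le_cosetDim_quot_add_one X ha
  omega

theorem torsionBound_inter_setOf_forall_evalAt_mul_cochar_eq_zero (hX : IsClosed X)
    (hirr : IsIrreducible X) (hn : n ≤ tr X + 1) (hlt : tr X < cosetDim X)
    (ih : ∀ Z : Set (Torus K n), IsIrreducible Z → tr Z < tr X → tr Z < cosetDim Z →
      TorsionBound Z (boundExponent (tr Z) 0))
    {P : Laurent K n} (hP : P ≠ 0) {a : Fin n → ℤ} (ha : a ≠ 0) :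
    TorsionBound (X ∩ {x | ∀ t, evalAt (x * cochar a t) P = 0}) (boundExponent (tr X) 0) := by
  by_cases hXa : X ⊆ {x | ∀ t, evalAt (x * cochar a t) P = 0}
  · have hstab (t) (x) (hx : x ∈ X) : cochar a t * x ∈ X :=
      cochar_mul_mem_of_forall_evalAt_eq_zero hX hirr hn hP hXa t hx
    obtain ⟨i₀, hi₀⟩ := Function.ne_iff.1 ha
    have htr := tr_image_add_one_le hirr ha hstab (quotMatrix_mulVecLin_self a i₀)
    have hYi := hirr.image _ (continuous_monomialMap (quotMatrix a i₀)).continuousOn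
    have hY := tr_lt_cosetDim_image_quotMatrix hirr hlt hi₀ hstab
    exact ((ih _ hYi htr hY).of_image_quotMatrix hi₀ (tr_pos_of_lt_cosetDim hYi hY) htr
      (Nat.zero_le _)).mono Set.inter_subset_left le_rfl
  · exact (torsionBound_of_ssubset hX hirr
      (hX.inter (isClosed_setOf_forall_evalAt_mul_cochar_eq_zero P a))
      (Set.inter_ssubset_left_iff.2 hXa)).mono subset_rfl (le_boundExponent (Nat.zero_le _))

theorem torsionBound_of_eq_tr_add_one (hX : IsClosed X) (hirr : IsIrreducible X)
    (hn : n = tr X + 1) (hlt : tr X < cosetDim X)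
    (ih : ∀ Z : Set (Torus K n), IsIrreducible Z → tr Z < tr X → tr Z < cosetDim Z →
      TorsionBound Z (boundExponent (tr Z) 0)) :
    TorsionBound X (boundExponent (tr X) 0) := by
  obtain ⟨P, hP, hPX⟩ := exists_ne_zero_mem_vanishingIdeal (X := X) (by omega)
  obtain ⟨𝒜, h𝒜fin, h𝒜ne, h𝒜⟩ := exists_finite_directions P
  have hiso := torsionBound_isolatedZeros (hn ▸ Nat.succ_pos _) P
  have hexp : (n : ℝ) - 1 / n ≤ boundExponent (tr X) 0 := by
    rw [boundExponent, Nat.cast_zero, sub_zero, ← Nat.cast_add_one, ← hn]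
  refine ((hiso.mono subset_rfl hexp).union (.biUnion h𝒜fin fun a ha =>
    torsionBound_inter_setOf_forall_evalAt_mul_cochar_eq_zero hX hirr hn.le hlt ih hP
      (h𝒜ne a ha))).mono (fun x hx => ?_) le_rfl
  by_cases h : ∀ a : Fin n → ℤ, a ≠ 0 → ∃ t, evalAt (x * cochar a t) P ≠ 0
  · exact Or.inl ⟨hPX x hx, h⟩
  · push Not at h
    obtain ⟨a, ha, hat⟩ := h
    obtain ⟨b, hb, hbt⟩ := h𝒜 x a ha hat
    exact Or.inr (Set.mem_biUnion hb ⟨hx, hbt⟩)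

theorem torsionBound_of_tr_lt_cosetDim (hirr : IsIrreducible X) (hlt : tr X < cosetDim X) :
    TorsionBound X (boundExponent (tr X) 0) := by
  induction hs : tr X using Nat.strong_induction_on generalizing n X with
  | _ s ih =>
  rw [← tr_closure, ← cosetDim_closure] at hlt
  rw [← tr_closure] at hs
  subst hs
  refine (torsionBound_of_hypersurface isClosed_closure hirr.closure hlt
    (le_boundExponent (Nat.zero_le _)) fun Y hY hYi htr hdim => ?_).mono subset_closure le_rfl
  exact (torsionBound_of_eq_tr_add_one hY hYi (by rw [htr]) (by omega)
    fun Z hZ hZY hZlt => ih _ (hZY.trans_eq htr) hZ hZlt rfl).mono subset_rfl (by rw [htr])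

end PowerSaving

section Stabilizer

variable {K : Type*} [Field K] {n : ℕ} {X : Set (Torus K n)}

/-- The stabilizer, as a submonoid of the torus. -/
def stabMonoid (X : Set (Torus K n)) : Submonoid (Torus K n) where
  carrier := stab X
  one_mem' x hx := by rwa [one_mul]
  mul_mem' hg hh x hx := by rw [mul_assoc]; exact hg _ (hh x hx)

/-- The directions of the one-parameter subgroups of the stabilizer. -/
def stabDirections (X : Set (Torus K n)) : Submodule ℤ (Fin n → ℤ) where
  carrier := {a | ∀ t, cochar a t ∈ stabMonoid X}
  zero_mem' t := by rw [cochar_zero]; exact one_mem _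
  add_mem' ha hb t := by rw [cochar_add]; exact mul_mem (ha t) (hb t)
  smul_mem' k a ha t := by rw [cochar_smul]; exact ha _

theorem isClosed_stab (hX : IsClosed X) : IsClosed (stab X) := by
  have : stab X = ⋂ x ∈ X, (fun g => x * g) ⁻¹' X := by ext g; simp [stab, mul_comm]
  rw [this]
  exact isClosed_biInter fun x _ => hX.preimage (continuous_mul_left_torus x)

theorem mem_stabDirections (hX : IsClosed X) {a : Fin n → ℤ}
    (ha : ∀ m ∈ relLattice (stab X), a ⬝ᵥ m = 0) : a ∈ stabDirections X := by
  refine fun t => mem_of_forall_chr_eq_one (isClosed_stab hX) fun m hm => ?_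
  rw [chr_cochar, ha m ⟨1, hm⟩, zpow_zero]

theorem le_finrank_add_finrank_of_forall_dotProduct (L V : Submodule ℤ (Fin n → ℤ))
    (hV : ∀ a, (∀ m ∈ L, a ⬝ᵥ m = 0) → a ∈ V) : n ≤ finrank ℤ V + finrank ℤ L := by
  let φ : (Fin n → ℤ) →ₗ[ℤ] (L →ₗ[ℤ] ℤ) := L.subtype.lcomp ℤ ℤ ∘ₗ dotProductBilin ℤ ℤ
  have hker : φ.ker ≤ V := fun a ha => hV a fun m hm => LinearMap.congr_fun ha ⟨m, hm⟩
  have hquot : finrank ℤ (_ ⧸ φ.ker) ≤ finrank ℤ L := by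
    rw [φ.quotKerEquivRange.finrank_eq]
    simpa [finrank_linearMap] using Submodule.finrank_le φ.range
  have hsum := φ.ker.finrank_quotient_add_finrank
  rw [finrank_fin_fun] at hsum
  have := Submodule.finrank_mono hker
  omega

theorem cosetDim_stab_le (hX : IsClosed X) :
    cosetDim (stab X) ≤ finrank ℤ (stabDirections X) := by
  have := cosetDim_add_finrank_relLattice (stab X)
  have := le_finrank_add_finrank_of_forall_dotProduct (relLattice (stab X)) (stabDirections X)
    fun _ => mem_stabDirections hX
  omega

theorem dim_le_cosetDim (S : Set (Torus K n)) : dim S ≤ cosetDim S := by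
  let f : IrreducibleCloseds S → ℕ := fun Z => tr (closure (Subtype.val '' (Z : Set S)))
  have hirr (Z : IrreducibleCloseds S) : IsIrreducible (closure (Subtype.val '' (Z : Set S))) :=
    (Z.isIrreducible.image _ continuous_subtype_val.continuousOn).closure
  have hf : StrictMono f := fun Z Z' hZ =>
    tr_lt_of_ssubset isClosed_closure (hirr Z') isClosed_closure (hirr Z)
      (SetLike.coe_ssubset_coe.2 (IrreducibleCloseds.map_strictMono_of_isInducing
        (Topology.IsInducing.subtypeVal (t := S)) hZ))
  have hle (Z : IrreducibleCloseds S) : f Z ≤ cosetDim S :=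
    (tr_le_cosetDim (hirr Z)).trans <| (cosetDim_closure _).trans_le <| cosetDim_anti
      fun m ⟨c, hc⟩ => ⟨c, by rintro _ ⟨z, -, rfl⟩; exact hc z z.2⟩
  refine iSup_le fun l => ?_
  have := LTSeries.head_add_length_le_nat (l.map f hf)
  rw [LTSeries.last_map] at this
  exact_mod_cast (Nat.le_of_add_left_le this).trans (hle _)

theorem dim_stab_le (hX : X.Nonempty) : dim (stab X) ≤ dim X := by
  obtain ⟨x₀, hx₀⟩ := hX
  let f : stab X → X := fun g => ⟨x₀ * g, by rw [mul_comm]; exact g.2 x₀ hx₀⟩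
  have hf : Topology.IsInducing f := Topology.IsInducing.subtypeVal.of_comp_iff.1
    ((translate x₀).isInducing.comp Topology.IsInducing.subtypeVal)
  exact hf.topologicalKrullDim_le

theorem map_stabDirections_le {k : ℕ} (B : Fin k → Fin n → ℤ) :
    (stabDirections X).map (Matrix.of B).mulVecLin ≤ stabDirections (monomialMap B '' X) := by
  rintro _ ⟨a, ha, rfl⟩ t _ ⟨x, hx, rfl⟩
  rw [← monomialMap_cochar, ← map_mul]
  exact Set.mem_image_of_mem _ (ha t x hx)

variable [Infinite K]

theorem lt_tr_and_torsionBound_boundExponent {δ : ℕ} (hirr : IsIrreducible X)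
    (hlt : tr X < cosetDim X) (hδ : δ ≤ finrank ℤ (stabDirections X)) :
    δ < tr X ∧ TorsionBound X (boundExponent (tr X) δ) := by
  induction δ generalizing n X with
  | zero => exact ⟨tr_pos_of_lt_cosetDim hirr hlt, torsionBound_of_tr_lt_cosetDim hirr hlt⟩
  | succ δ ih =>
    obtain ⟨a, ha, ha0⟩ := (stabDirections X).exists_mem_ne_zero_of_ne_bot fun h => by
      rw [h, finrank_bot] at hδ
      omega
    obtain ⟨i₀, hi₀⟩ := Function.ne_iff.1 ha0
    have hdir := (finrank_le_finrank_map_quotMatrix_add_one (stabDirections X) hi₀).trans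
      (Nat.add_le_add_right (Submodule.finrank_mono (map_stabDirections_le _)) 1)
    obtain ⟨hδtr, hbound⟩ := ih (hirr.image _ (continuous_monomialMap _).continuousOn)
      (tr_lt_cosetDim_image_quotMatrix hirr hlt hi₀ ha) (by omega)
    have htr := tr_image_add_one_le hirr ha0 ha (quotMatrix_mulVecLin_self a i₀)
    exact ⟨by omega, hbound.of_image_quotMatrix hi₀ hδtr htr le_rfl⟩

end Stabilizer

end AlgTorus

open AlgTorus Module

theorem theorem1p2 {K : Type*} [Field K] [IsAlgClosed K] {n : ℕ}
    (X : Set (AlgTorus.Torus K n)) (hX : AlgTorus.IsAlgebraicSet X)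
    (hirr : IsIrreducible X) (hadm : AlgTorus.IsAdmissible X)
    (d δ : ℕ) (hd : AlgTorus.dim X = (d : WithBot ℕ∞))
    (hδ : AlgTorus.dim (AlgTorus.stab X) = (δ : WithBot ℕ∞)) :
    δ ≤ d ∧ ∃ C : ℝ, ∀ T : ℝ, 1 ≤ T →
      (AlgTorus.torsionUpTo X T).Finite ∧
      ((AlgTorus.torsionUpTo X T).ncard : ℝ) ≤
        C * T ^ ((d : ℝ) + 1 - 1 / ((d : ℝ) - (δ : ℝ) + 1)) := by
  have hδd : δ ≤ d := by exact_mod_cast hδ ▸ hd ▸ dim_stab_le hirr.1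
  suffices h : TorsionBound X (boundExponent d δ) by
    obtain ⟨C, hC⟩ := h
    exact ⟨hδd, C, fun T hT => ⟨finite_torsionUpTo X T, hC T hT⟩⟩
  rcases hadm with hfin | hadm
  · exact torsionBound_of_finite hfin (d.cast_nonneg.trans (le_boundExponent hδd))
  have := IsAlgClosed.instInfinite (K := K)
  by_cases hlt : tr X < cosetDim X
  · have hδV : δ ≤ finrank ℤ (stabDirections X) := by
      exact_mod_cast (hδ ▸ dim_le_cosetDim (stab X)).trans
        (Nat.cast_le.2 (cosetDim_stab_le hX.isClosed))
    have htr : tr X ≤ d := by exact_mod_cast hd ▸ tr_le_dim hX.isClosed hirr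
    obtain ⟨hδtr, hbound⟩ := lt_tr_and_torsionBound_boundExponent hirr hlt hδV
    exact hbound.mono subset_rfl (boundExponent_mono_left hδtr.le htr)
  · refine torsionBound_of_forall_not_isOfFinOrder _ fun ζ hζX hζ => ?_
    exact hadm X (isTorsionCoset_of_cosetDim_le_tr hX.isClosed hirr (not_lt.1 hlt) hζX hζ) rfl
      subset_rfl
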